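/- Let $V$ be a finite-dimensional vector space over a field $\Bbbk$ and let $G\subset \mathrm{GL}(V)$ be a finite group with $\operatorname{char}\Bbbk\nmid |G|$, generated by pseudo-reflections, i.e. by elements $g$ with $\operatorname{codim}\ker(1-g)=1$. Let $S=S(V^*)$ be the algebra of polynomial functions on $V$, $R=S^G$, $L=\operatorname{Frac} S$, $K=L^G=\operatorname{Frac}R$. Here $G$ acts by $g(p)(v)=p(g^{-1}v)$, and $V$ acts on $S$ and $L$ by translations, $t_w(p)(v)=p(v-w)$. Let $L\ast V$ be the skew group algebra, i.e. the free left $L$-module on $\{t_v\}_{v\in V}$ with $(at_v)(bt_w)=a\,t_v(b)\,t_{v+w}$, and let $S\ast V\subset L\ast V$ be the subring of elements with coefficients in $S$. The group $G$ acts on $L\ast V$ by $g(at_v)=g(a)t_{g(v)}$. For each reflecting hyperplane $H=\ker(1-g)$ ($g\in G$ a pseudo-reflection) choose $\alpha_H\in V^*$ with $\ker\alpha_H=H$ and a generator $s_H$ of the (cyclic) pointwise stabilizer of $H$ in $G$. For a linear character $\chi:G\to\Bbbk^\times$ put $d_\chi=\prod_H\alpha_H^{a_H}\in S$, where $a_H$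 is the least non-negative integer with $\chi(s_H)=\det(s_H^*)^{a_H}$, $s_H^*$ denoting the action of $s_H$ on $V^*$. For $X=\sum_v x_vt_v\in L\ast V$ put $\operatorname{Supp}(X)=\{v\mid x_v\ne0\}$, $X(a)=\sum_v x_v\,t_v(a)$ for $a\in L$, and $X^\dagger=\sum_v t_{-v}x_v$. For a $G$-stable submonoid $\mathscr M\subset V$ let $L\ast\mathscr M\subset L\ast V$ be the subring of elements with support in $\mathscr M$ and $\mathscr K=(L\ast\mathscr M)^G$. A subring $\mathscr U$ with $R\subset\mathscr U\subset\mathscr K$ is a *Galois $R$-order in $\mathscr K$* if $\mathscr UK=\mathscr K=K\mathscr U$ and, for every finite-dimensional left (respectively right) $K$-subspace $W\subset\mathscr K$, the intersection $W\cap\mathscr U$ is a finitely generated left (respectively right) $R$-module. A Galois $R$-order $\mathscr U$ in $\mathscr K$ is *principal* if $X(\gamma)\in R$ for all $X\in\mathscr U$, $\gamma\in R$, and *co-principal* if $X^\dagger(\gamma)\in R$ for all $X\in\mathscr U$, $\gamma\in R$. **Theorem.** Let $\mathscr X\subset L\ast V$ be a subset such that (i) $g(X)=X$ for all $g\in G$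 and $X\in\mathscr X$; (ii) for every $X\in\mathscr X$ there is a linear character $\chi:G\to\Bbbk^\times$ such that $d_\chi\cdot X\in S\ast V$ (respectively $X\cdot d_\chi\in S\ast V$). Let $\mathscr M\subset V$ be the submonoid generated by $\bigcup_{X\in\mathscr X}\operatorname{Supp}(X)$, and let $\mathscr U(G,\mathscr X)$ be the subring of $L\ast V$ generated by $R\cup\mathscr X$. Then $\mathscr U(G,\mathscr X)$ is a principal (respectively co-principal) Galois $R$-order in $(L\ast\mathscr M)^G$. Moreover, the standing assumptions for Galois orders hold already under (i): as automorphisms of $S$, the translations $t_{m-m'}$ with $m,m'\in\mathscr M$ meet $G$ only in the identity; $\mathscr M$ is $G$-stable; and $S$ is a noetherian $R$-module. -/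

import Mathlib

namespace GaloisOrder

/-! ### Galois rings and Galois orders inside an ambient ring

`Γ` and `K` are commutative subrings of `A` (`K` a field), and `𝒦 ⊆ A` is the carrier of the ring of
invariants. -/

section Abstract

variable {A : Type*} [Ring A]

/-- The additive subgroup of `A` spanned by the products `b * c` with `b ∈ B`, `c ∈ C`. -/
def productSpan (B C : Subring A) : AddSubgroup A :=
  AddSubgroup.closure {z | ∃ b ∈ B, ∃ c ∈ C, z = b * c}

/-- `T ⊆ A` is a finitely generated left `Γ`-submodule of `A`. -/
def IsFGLeft (Γ : Subring A) (T : Set A) : Prop :=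
  ∃ F : Finset A, (Submodule.span Γ (F : Set A) : Set A) = T

/-- `T ⊆ A` is a finitely generated right `Γ`-submodule of `A`. -/
def IsFGRight (Γ : Subring A) (T : Set A) : Prop :=
  ∃ F : Finset A, (Submodule.span Γ.op (F : Set A) : Set A) = T

/-- `U` is a Galois `Γ`-ring in `𝒦`: a subring with `Γ ⊆ U ⊆ 𝒦` and `U K = 𝒦 = K U`. -/
structure IsGaloisRing (Γ K : Subring A) (𝒦 : Set A) (U : Subring A) : Prop where
  base_le : Γ ≤ U
  le_invariants : (U : Set A) ⊆ 𝒦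
  mul_right : (productSpan U K : Set A) = 𝒦
  mul_left : (productSpan K U : Set A) = 𝒦

/-- `U` is a Galois `Γ`-order in `𝒦`: a Galois `Γ`-ring such that `W ∩ U` is a finitely generated
left (right) `Γ`-module for every finite-dimensional left (right) `K`-subspace `W ⊆ 𝒦`. -/
structure IsGaloisOrder (Γ K : Subring A) (𝒦 : Set A) (U : Subring A) : Prop
    extends IsGaloisRing Γ K 𝒦 U where
  left_order : ∀ W : Submodule K A, W.FG → (W : Set A) ⊆ 𝒦 →
    IsFGLeft Γ ((W : Set A) ∩ (U : Set A))
  right_order : ∀ W : Submodule K.op A, W.FG → (W : Set A) ⊆ 𝒦 →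
    IsFGRight Γ ((W : Set A) ∩ (U : Set A))

end Abstract

/-! ### Invariants in skew monoid rings

`L` is a field, `Λ` a subring of `L`, and `N` and `G` are groups acting on `L`; `G` also acts on `N`
(by conjugation of automorphisms).  The skew group ring `L ∗ N` is `SkewMonoidAlgebra L N`, with
`(a μ) (b ν) = a μ(b) μν`.  For a submonoid `M` of `N`, the skew monoid ring `L ∗ M` is the set of
elements of `L ∗ N` with support in `M`. -/

section Skew

variable {L N : Type*} [Field L] [Group N] [MulSemiringAction N L]

/-- Evaluation `X(a) = ∑ x_μ μ(a)`. -/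
noncomputable def evaluation (X : SkewMonoidAlgebra L N) (a : L) : L :=
  X.sum fun μ x => x * μ • a

/-- The anti-automorphism `†` of `L ∗ N` with `a† = a` and `μ† = μ⁻¹`, so that
`(x μ)† = μ⁻¹ x`. -/
noncomputable def dagger (X : SkewMonoidAlgebra L N) : SkewMonoidAlgebra L N :=
  X.sum fun μ x => SkewMonoidAlgebra.single μ⁻¹ 1 * SkewMonoidAlgebra.single 1 x

/-- The elements of `L ∗ N` with coefficients in `Λ`, i.e. `Λ ∗ N`. -/
def integralElements (Λ : Subring L) : Set (SkewMonoidAlgebra L N) :=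
  {X | ∀ μ, X.coeff μ ∈ Λ}

variable (G : Type*) [Group G] [MulSemiringAction G L] [MulAction G N]

/-- The action of `G` on `L ∗ N`, given by `g (a μ) = g(a) ᵍμ`. -/
noncomputable def skewAct {G : Type*} [Group G] [MulSemiringAction G L] [MulAction G N]
    (g : G) (X : SkewMonoidAlgebra L N) : SkewMonoidAlgebra L N :=
  X.sum fun μ x => SkewMonoidAlgebra.single (g • μ) (g • x)

/-- The invariants `Γ = Λ^G`, as a subring of `L`. -/
def invariantBase (Λ : Subring L) : Subring L :=
  Λ ⊓ (FixedPoints.subfield G L).toSubring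

/-- `Γ = Λ^G` as a subring of `L ∗ N`. -/
noncomputable def baseRing (N : Type*) [Group N] [MulSemiringAction N L] (Λ : Subring L) :
    Subring (SkewMonoidAlgebra L N) :=
  (invariantBase G Λ).map SkewMonoidAlgebra.singleOneRingHom

/-- The field `K = L^G` as a subring of `L ∗ N`. -/
noncomputable def baseField (L N : Type*) [Field L] [Group N] [MulSemiringAction N L]
    [MulSemiringAction G L] : Subring (SkewMonoidAlgebra L N) :=
  (FixedPoints.subfield G L).toSubring.map SkewMonoidAlgebra.singleOneRingHom

/-- `𝒦 = (L ∗ M)^G`. -/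
def invariants (L : Type*) [Field L] [MulSemiringAction N L] [MulSemiringAction G L]
    (M : Submonoid N) : Set (SkewMonoidAlgebra L N) :=
  {X | (∀ μ ∈ X.support, μ ∈ M) ∧ ∀ g : G, skewAct g X = X}

/-- The standard Galois order `𝒦_Γ = {X ∈ 𝒦 | X(γ) ∈ Γ for all γ ∈ Γ}`. -/
def standardOrder (Λ : Subring L) (M : Submonoid N) : Set (SkewMonoidAlgebra L N) :=
  {X ∈ invariants G L M | ∀ γ ∈ invariantBase G Λ, evaluation X γ ∈ invariantBase G Λ}

/-- The co-standard Galois order `{X ∈ 𝒦 | X†(γ) ∈ Γ for all γ ∈ Γ}`. -/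
def costandardOrder (Λ : Subring L) (M : Submonoid N) : Set (SkewMonoidAlgebra L N) :=
  {X ∈ invariants G L M | ∀ γ ∈ invariantBase G Λ, evaluation (dagger X) γ ∈ invariantBase G Λ}

/-- `U` is a principal Galois `Γ`-order in `(L ∗ M)^G`. -/
def IsPrincipalGaloisOrder (Λ : Subring L) (M : Submonoid N)
    (U : Subring (SkewMonoidAlgebra L N)) : Prop :=
  IsGaloisOrder (baseRing G N Λ) (baseField G L N) (invariants G L M) U ∧
    (U : Set (SkewMonoidAlgebra L N)) ⊆ standardOrder G Λ M

/-- `U` is a co-principal Galois `Γ`-order in `(L ∗ M)^G`. -/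
def IsCoprincipalGaloisOrder (Λ : Subring L) (M : Submonoid N)
    (U : Subring (SkewMonoidAlgebra L N)) : Prop :=
  IsGaloisOrder (baseRing G N Λ) (baseField G L N) (invariants G L M) U ∧
    (U : Set (SkewMonoidAlgebra L N)) ⊆ costandardOrder G Λ M

/-- `Λ` as a module over `Γ = Λ^G`. -/
def asBaseModule (Λ : Subring L) : Submodule (invariantBase G Λ) L where
  carrier := Λ
  add_mem' := Λ.add_mem
  zero_mem' := Λ.zero_mem
  smul_mem' := fun c _ hx => Λ.mul_mem c.2.1 hx

/-- The standing assumptions on `(Λ, G, M)` under which Galois orders in `(L ∗ M)^G` are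
considered. -/
structure StandingAssumptions (Λ : Subring L) (M : Submonoid N) : Prop where
  /-- `M M⁻¹ ∩ G = 1` as automorphisms of `Λ`. -/
  separation : ∀ m₁ ∈ M, ∀ m₂ ∈ M, ∀ g : G, (∀ a ∈ Λ, (m₁ * m₂⁻¹) • a = g • a) →
    ∀ a ∈ Λ, g • a = a
  /-- `ᵍμ ∈ M` for `g ∈ G` and `μ ∈ M`. -/
  invariance : ∀ g : G, ∀ μ ∈ M, g • μ ∈ M
  /-- `Λ` is a noetherian `Λ^G`-module. -/
  finiteness : IsNoetherian (invariantBase G Λ) (asBaseModule G Λ)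

end Skew

/-! ### Polynomial functions on `V`, with `GL(V)` and `V` acting -/

section Polynomial

open Module SymmetricAlgebra

variable (k V : Type*) [Field k] [AddCommGroup V] [Module k V]

/-- `S = S(V*)`, the algebra of polynomial functions on `V`. -/
abbrev PolyFun := SymmetricAlgebra k (Dual k V)

/-- `L = Frac S`. -/
abbrev RatFun := FractionRing (PolyFun k V)

/-- `S` as a subring of `L`. -/
def polySubring : Subring (RatFun k V) := (algebraMap (PolyFun k V) (RatFun k V)).range

variable {k V}

/-- The action of `GL(V)` on `V*`: `(g α)(v) = α(g⁻¹ v)`. -/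
def contragredient (g : V ≃ₗ[k] V) : Dual k V ≃ₗ[k] Dual k V := (g⁻¹ : V ≃ₗ[k] V).dualMap

lemma contragredient_apply (g : V ≃ₗ[k] V) (α : Dual k V) (v : V) :
    contragredient g α v = α (g⁻¹ v) := rfl

lemma contragredient_mul (g h : V ≃ₗ[k] V) (α : Dual k V) :
    contragredient (g * h) α = contragredient g (contragredient h α) := by
  ext v
  simp [contragredient_apply, mul_inv_rev]

lemma contragredient_one (α : Dual k V) : contragredient (1 : V ≃ₗ[k] V) α = α := by
  ext v
  simp [contragredient_apply]

/-- The algebra endomorphism of `S` extending the action of `g` on `V*`. -/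
def linHom (g : V ≃ₗ[k] V) : PolyFun k V →ₐ[k] PolyFun k V :=
  SymmetricAlgebra.lift (ι k (Dual k V) ∘ₗ (contragredient g).toLinearMap)

@[simp] lemma linHom_ι (g : V ≃ₗ[k] V) (α : Dual k V) :
    linHom g (ι k (Dual k V) α) = ι k (Dual k V) (contragredient g α) := by
  simp [linHom]

lemma linHom_mul (g h : V ≃ₗ[k] V) : linHom (g * h) = (linHom g).comp (linHom h) := by
  apply SymmetricAlgebra.algHom_ext
  ext α
  simp [contragredient_mul]

lemma linHom_one : linHom (1 : V ≃ₗ[k] V) = AlgHom.id k (PolyFun k V) := by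
  apply SymmetricAlgebra.algHom_ext
  ext α
  simp [contragredient_one]

/-- The action of `GL(V)` on `S`: `g(p)(v) = p(g⁻¹ v)`. -/
def linAction : (V ≃ₗ[k] V) →* (PolyFun k V ≃+* PolyFun k V) where
  toFun g := (AlgEquiv.ofAlgHom (linHom g) (linHom g⁻¹)
    (by rw [← linHom_mul, mul_inv_cancel, linHom_one])
    (by rw [← linHom_mul, inv_mul_cancel, linHom_one])).toRingEquiv
  map_one' := RingEquiv.ext fun p => DFunLike.congr_fun linHom_one p
  map_mul' g h := RingEquiv.ext fun p => DFunLike.congr_fun (linHom_mul g h) p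

/-- The algebra endomorphism `t_w` of `S`, determined by `t_w(α) = α - α(w)` for `α ∈ V*`. -/
def transHom (w : V) : PolyFun k V →ₐ[k] PolyFun k V :=
  SymmetricAlgebra.lift
    (ι k (Dual k V) - Algebra.linearMap k (PolyFun k V) ∘ₗ Dual.eval k V w)

@[simp] lemma transHom_ι (w : V) (α : Dual k V) :
    transHom w (ι k (Dual k V) α) = ι k (Dual k V) α - algebraMap k (PolyFun k V) (α w) := by
  simp [transHom]

lemma transHom_add (v w : V) :
    transHom (k := k) (v + w) = (transHom v).comp (transHom w) := by
  apply SymmetricAlgebra.algHom_ext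
  ext α
  simp
  abel

lemma transHom_zero : transHom (k := k) (0 : V) = AlgHom.id k (PolyFun k V) := by
  apply SymmetricAlgebra.algHom_ext
  ext α
  simp

/-- The action of `V` on `S` by translations: `t_w(p)(v) = p(v - w)`. -/
def transAction : Multiplicative V →* (PolyFun k V ≃+* PolyFun k V) where
  toFun w := (AlgEquiv.ofAlgHom (transHom w.toAdd) (transHom (-w.toAdd))
    (by rw [← transHom_add, add_neg_cancel, transHom_zero])
    (by rw [← transHom_add, neg_add_cancel, transHom_zero])).toRingEquiv
  map_one' := RingEquiv.ext fun p => DFunLike.congr_fun transHom_zero p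
  map_mul' v w := RingEquiv.ext fun p => DFunLike.congr_fun (transHom_add v.toAdd w.toAdd) p

/-- The action of `GL(V)` on `L = Frac S`, extending the one on `S`. -/
noncomputable instance instLinActionRatFun : MulSemiringAction (V ≃ₗ[k] V) (RatFun k V) :=
  MulSemiringAction.compHom (RatFun k V)
    ((IsFractionRing.ringEquivOfRingEquivHom (PolyFun k V) (RatFun k V)).comp linAction)

/-- The action of `V` on `L = Frac S` by translations, extending the one on `S`. -/
noncomputable instance instTransActionRatFun :
    MulSemiringAction (Multiplicative V) (RatFun k V) :=
  MulSemiringAction.compHom (RatFun k V)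
    ((IsFractionRing.ringEquivOfRingEquivHom (PolyFun k V) (RatFun k V)).comp transAction)

/-- `GL(V)` acts on the group of translations by `ᵍ(t_v) = t_{g v}`. -/
instance instLinActionTranslations : MulAction (V ≃ₗ[k] V) (Multiplicative V) where
  smul g v := Multiplicative.ofAdd (g v.toAdd)
  one_smul _ := rfl
  mul_smul _ _ _ := rfl

variable (k V) in
/-- The skew group algebra `L ∗ V`; the element `a t_v` is `single (Multiplicative.ofAdd v) a`. -/
abbrev SkewRatFun := SkewMonoidAlgebra (RatFun k V) (Multiplicative V)

/-- A polynomial function as an element of `L ∗ V`. -/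
noncomputable def polyToSkew (p : PolyFun k V) : SkewRatFun k V :=
  SkewMonoidAlgebra.single 1 (algebraMap (PolyFun k V) (RatFun k V) p)

end Polynomial

/-! ### Reflection groups and relative Jacobians -/

section Reflection

open Module

variable {k V : Type*} [Field k] [AddCommGroup V] [Module k V]

/-- The fixed space `ker(1 - g)`. -/
def fixedSpace (g : V ≃ₗ[k] V) : Submodule k V :=
  LinearMap.ker (LinearMap.id - g.toLinearMap)

/-- `g` is a pseudo-reflection: `codim ker(1 - g) = 1`. -/
def IsPseudoReflection (g : V ≃ₗ[k] V) : Prop := finrank k (V ⧸ fixedSpace g) = 1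

/-- `G` is generated by pseudo-reflections. -/
def IsReflectionGroup (G : Subgroup (V ≃ₗ[k] V)) : Prop :=
  Subgroup.closure {g | g ∈ G ∧ IsPseudoReflection g} = G

/-- The set of reflecting hyperplanes of `G`. -/
def reflectingHyperplanes (G : Subgroup (V ≃ₗ[k] V)) : Set (Submodule k V) :=
  {H | ∃ g ∈ G, IsPseudoReflection g ∧ H = fixedSpace g}

/-- For each reflecting hyperplane `H`, a choice of a linear form with kernel `H` and of a
generator of the (pointwise) stabilizer of `H` in `G`. -/
structure HyperplaneData (G : Subgroup (V ≃ₗ[k] V)) where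
  form : reflectingHyperplanes G → Dual k V
  ker_form : ∀ H, LinearMap.ker (form H) = H
  gen : reflectingHyperplanes G → G
  zpowers_gen : ∀ H : reflectingHyperplanes G,
    Subgroup.zpowers (gen H) = fixingSubgroup G ((H : Submodule k V) : Set V)

/-- Such data exist as soon as `|G|` is invertible in `k`. -/
lemma hyperplaneData_nonempty (G : Subgroup (V ≃ₗ[k] V)) [Finite G] (hchar : (Nat.card G : k) ≠ 0) :
    Nonempty (HyperplaneData G) := by
  have hform : ∀ H : reflectingHyperplanes G, ∃ α : Dual k V, LinearMap.ker α = H := by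
    rintro ⟨H, g, hg, hr, rfl⟩
    have : FiniteDimensional k (V ⧸ fixedSpace g) := Module.finite_of_finrank_eq_succ hr
    let e : (V ⧸ fixedSpace g) ≃ₗ[k] k :=
      LinearEquiv.ofFinrankEq _ _ (hr.trans (finrank_self k).symm)
    exact ⟨e.toLinearMap ∘ₗ (fixedSpace g).mkQ, by rw [LinearEquiv.ker_comp, Submodule.ker_mkQ]⟩
  choose f hf using hform
  have hgen : ∀ H : reflectingHyperplanes G, ∃ s : G,
      Subgroup.zpowers s = fixingSubgroup G ((H : Submodule k V) : Set V) := by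
    intro H
    have hmem : ∀ v, v ∈ (H : Submodule k V) ↔ f H v = 0 := fun v => by
      rw [← hf H, LinearMap.mem_ker]
    obtain ⟨v₀, hv₀⟩ : ∃ v₀, f H v₀ = 1 := by
      by_cases h0 : f H = 0
      · obtain ⟨H, g, hg, hr, rfl⟩ := H
        have : fixedSpace g = ⊤ := by
          have h1 := hf ⟨fixedSpace g, g, hg, hr, rfl⟩
          rw [h0, LinearMap.ker_zero] at h1
          exact h1.symm
        rw [IsPseudoReflection, this, finrank_zero_of_subsingleton] at hr
        omega
      · exact LinearMap.surjective h0 1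
    have hfix : ∀ g : fixingSubgroup G ((H : Submodule k V) : Set V), ∀ v, f H v = 0 →
        ((g : G) : V ≃ₗ[k] V) v = v := fun g v hv => g.2 ⟨v, (hmem v).2 hv⟩
    have hscal : ∀ g : fixingSubgroup G ((H : Submodule k V) : Set V), ∀ v,
        f H (((g : G) : V ≃ₗ[k] V) v) = f H v * f H (((g : G) : V ≃ₗ[k] V) v₀) := by
      intro g v
      have h := hfix g (v - f H v • v₀) (by simp [hv₀])
      have h2 := congrArg (f H) h
      simp [hv₀] at h2
      linear_combination h2
    let φ : fixingSubgroup G ((H : Submodule k V) : Set V) →* k :=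
      { toFun := fun g => f H (((g : G) : V ≃ₗ[k] V) v₀)
        map_one' := by simp [hv₀]
        map_mul' := fun g h => by
          have := hscal g (((h : G) : V ≃ₗ[k] V) v₀)
          simpa [mul_comm] using this }
    have hinj : Function.Injective φ := by
      rw [injective_iff_map_eq_one]
      intro g hg
      have hg' : f H (((g : G) : V ≃ₗ[k] V) v₀) = 1 := hg
      have hpow : ∀ n : ℕ, (((g ^ n : fixingSubgroup G ((H : Submodule k V) : Set V)) : G) :
          V ≃ₗ[k] V) v₀ = v₀ + (n : k) • (((g : G) : V ≃ₗ[k] V) v₀ - v₀) := by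
        intro n
        induction n with
        | zero => simp
        | succ n ih =>
          have h1 := hfix g (((g : G) : V ≃ₗ[k] V) v₀ - v₀) (by simp [hv₀, hg'])
          rw [pow_succ']
          have : ((((g * g ^ n : fixingSubgroup G ((H : Submodule k V) : Set V)) : G) :
            V ≃ₗ[k] V) v₀) = ((g : G) : V ≃ₗ[k] V) ((((g ^ n :
            fixingSubgroup G ((H : Submodule k V) : Set V)) : G) : V ≃ₗ[k] V) v₀) := rfl
          rw [this, ih, map_add, map_smul, h1]
          push_cast
          module
      have hone := hpow (Nat.card G)
      have hcard : g ^ Nat.card G = 1 := Subtype.ext (by simp [pow_card_eq_one'])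
      rw [hcard] at hone
      have hz : (Nat.card G : k) • (((g : G) : V ≃ₗ[k] V) v₀ - v₀) = 0 := by
        simpa using hone
      have hv : ((g : G) : V ≃ₗ[k] V) v₀ = v₀ :=
        sub_eq_zero.1 ((smul_eq_zero.1 hz).resolve_left hchar)
      refine Subtype.ext (Subtype.ext (LinearEquiv.ext fun v => ?_))
      have h := hfix g (v - f H v • v₀) (by simp [hv₀])
      rw [map_sub, map_smul, hv] at h
      simpa using h
    have hcyc : IsCyclic (fixingSubgroup G ((H : Submodule k V) : Set V)) :=
      isCyclic_of_injective_ringHom φ hinj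
    exact (Subgroup.isCyclic_iff_exists_zpowers_eq_top _).1 hcyc
  choose s hs using hgen
  exact ⟨⟨f, hf, s, hs⟩⟩

variable {G : Subgroup (V ≃ₗ[k] V)}

/-- The least non-negative integer `a` with `χ(s_H) = det(s_H^*) ^ a`, where `s_H^*` is the action of
`s_H` on `V*`. -/
noncomputable def hyperplaneExponent (D : HyperplaneData G) (χ : G →* kˣ)
    (H : reflectingHyperplanes G) : ℕ :=
  sInf {a : ℕ | χ (D.gen H) = LinearEquiv.det (contragredient (D.gen H : V ≃ₗ[k] V)) ^ a}

/-- The polynomial `d_χ = ∏ (α_H) ^ (a_H)`, over the reflecting hyperplanes `H` of `G` (which are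
finite in number when `G` is finite). -/
noncomputable def relativeJacobian (D : HyperplaneData G) (χ : G →* kˣ) : PolyFun k V :=
  ∏ᶠ H : reflectingHyperplanes G,
    SymmetricAlgebra.ι k (Dual k V) (D.form H) ^ hyperplaneExponent D χ H

/-- The submonoid of (translations by elements of) `V` generated by the supports of the elements
of `𝒳`. -/
def supportMonoid (𝒳 : Set (SkewRatFun k V)) : Submonoid (Multiplicative V) :=
  Submonoid.closure (⋃ X ∈ 𝒳, (X.support : Set (Multiplicative V)))

/-- The subring of `L ∗ V` generated by `R = S^G` and `𝒳`. -/
noncomputable def generatedRing (G : Subgroup (V ≃ₗ[k] V)) (𝒳 : Set (SkewRatFun k V)) :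
    Subring (SkewRatFun k V) :=
  Subring.closure
    (baseRing (L := RatFun k V) G (Multiplicative V) (polySubring k V) ∪ 𝒳)

end Reflection

end GaloisOrder

open GaloisOrder

namespace GaloisOrder

open SkewMonoidAlgebra

set_option linter.unusedSectionVars false

/-! ### Formal properties of evaluation, `†` and the `G`-action on `L ∗ N` -/

section SkewBasics

variable {L N : Type*} [Field L] [Group N] [MulSemiringAction N L]

/-! The heart of the matter is that each generator `X` maps `R` to `R`. For `r ∈ R` the rational
function `f = X(r)` is `G`-invariant, because `g(X(r)) = (gX)(g r)`, and `d_χ f` is a polynomial,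
because translations preserve `S`. An invariant `f` cannot have `α_H` in its denominator. Write `p =
α_H ^ b q f` with `p, q ∈ S`, `α_H ∤ q` and `0 < b ≤ a_H`, and let `ζ = det(s_H^*)`, the scalar by
which `s_H` acts on `α_H`. Applying `s_H` gives `ζ ^ b p s_H(q) = s_H(p) q`. Since `s_H` is the
identity modulo `α_H`, it follows that `α_H` divides `(ζ ^ b - 1) p q`. Minimality of `a_H` forces
`ζ ^ b ≠ 1`, so the prime `α_H` divides `p` and one factor cancels. Repetition gives `f ∈ S`
(`HyperplaneData.ι_form_dvd_of_invariant`, `mem_polySubring_of_formProduct_mul`). Evaluation turns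
products into compositions, so the whole generated ring preserves `R`.

The rest is general and depends on one fact: distinct translations stay distinct on `R`
(`transHom_separation`). By Dedekind's theorem they are then `L`-independent functions on `R`, so
for finite `F` the vectors `(μ(r))_{μ ∈ F}`, `r ∈ R`, span `L ^ F` (`span_baseCharacter`). This is
used twice. First, it isolates single terms `a μ` inside the `L`-span of `U`; averaging over `G`,
whose order is invertible, turns `L`-coefficients into `K`-coefficients, and `K U` is everything
(`isGaloisRing_of_support`). Secondly, it recovers the coefficients of `X` from the values `X(r) ∈
S` with a denominator that depends only on `F`. A finite-dimensional `W` has supports in some finite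
`F`, so `W ∩ U` lies in a copy of `S ^ F`, which is noetherian over `R` (`isFGLeft_inter`).

The anti-automorphism `†` exchanges left with right and the principal case with the co-principal
one. -/

lemma skew_induction {p : SkewMonoidAlgebra L N → Prop} (X : SkewMonoidAlgebra L N)
    (zero : p 0) (single : ∀ μ x, p (single μ x)) (add : ∀ X Y, p X → p Y → p (X + Y)) : p X :=
  X.induction_on zero single (fun {X Y} => add X Y)

/-! #### Evaluation -/

lemma evaluation_single (μ : N) (x a : L) : evaluation (single μ x) a = x * μ • a :=
  sum_single_index (by simp)

lemma evaluation_zero_left (a : L) : evaluation (0 : SkewMonoidAlgebra L N) a = 0 :=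
  sum_zero_index

lemma evaluation_add_left (X Y : SkewMonoidAlgebra L N) (a : L) :
    evaluation (X + Y) a = evaluation X a + evaluation Y a :=
  sum_add_index' (by simp) (by intros; ring)

lemma evaluation_add_right (X : SkewMonoidAlgebra L N) (a b : L) :
    evaluation X (a + b) = evaluation X a + evaluation X b := by
  simp only [evaluation, smul_add, mul_add, sum_add]

lemma evaluation_zero_right (X : SkewMonoidAlgebra L N) : evaluation X 0 = 0 := by
  simpa using evaluation_add_right X 0 0

lemma evaluation_neg_left (X : SkewMonoidAlgebra L N) (a : L) :
    evaluation (-X) a = -evaluation X a := by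
  rw [eq_neg_iff_add_eq_zero, ← evaluation_add_left, neg_add_cancel, evaluation_zero_left]

lemma evaluation_one (a : L) : evaluation (1 : SkewMonoidAlgebra L N) a = a := by
  rw [one_def, evaluation_single, one_smul, one_mul]

/-- Evaluation is the natural action of `L ∗ N` on `L`, so preservation of `Γ` need only be tested
on ring generators. -/
lemma evaluation_mul (X Y : SkewMonoidAlgebra L N) (a : L) :
    evaluation (X * Y) a = evaluation X (evaluation Y a) := by
  induction X using skew_induction with
  | zero => simp [evaluation_zero_left]
  | add X X' h h' => rw [add_mul, evaluation_add_left, evaluation_add_left, h, h']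
  | single μ x =>
    induction Y using skew_induction with
    | zero => simp [evaluation_zero_left, evaluation_zero_right]
    | add Y Y' h h' =>
      rw [mul_add, evaluation_add_left, evaluation_add_left, evaluation_add_right, h, h']
    | single ν y => simp [evaluation_single, mul_smul, mul_assoc]

lemma evaluation_eq_sum {X : SkewMonoidAlgebra L N} {F : Finset N} (h : X.support ⊆ F) (a : L) :
    evaluation X a = ∑ μ ∈ F, X.coeff μ * μ • a := by
  rw [evaluation, sum_def']
  exact Finset.sum_subset h fun μ _ hμ => by simp [notMem_support_iff.1 hμ]

/-! #### The anti-automorphism -/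

lemma dagger_single (μ : N) (x : L) : dagger (single μ x) = single μ⁻¹ (μ⁻¹ • x) := by
  rw [dagger, sum_single_index (by simp)]
  simp

lemma dagger_zero : dagger (0 : SkewMonoidAlgebra L N) = 0 :=
  sum_zero_index

lemma dagger_add (X Y : SkewMonoidAlgebra L N) : dagger (X + Y) = dagger X + dagger Y :=
  sum_add_index' (by simp) (by intros; rw [single_add, mul_add])

lemma dagger_neg (X : SkewMonoidAlgebra L N) : dagger (-X) = -dagger X := by
  rw [eq_neg_iff_add_eq_zero, ← dagger_add, neg_add_cancel, dagger_zero]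

lemma dagger_one : dagger (1 : SkewMonoidAlgebra L N) = 1 := by
  rw [one_def, dagger_single]
  simp

lemma dagger_single_one (x : L) : dagger (single (1 : N) x) = single 1 x := by
  rw [dagger_single]
  simp

lemma dagger_mul (X Y : SkewMonoidAlgebra L N) : dagger (X * Y) = dagger Y * dagger X := by
  induction X using skew_induction with
  | zero => simp [dagger_zero]
  | add X X' h h' => rw [add_mul, dagger_add, dagger_add, mul_add, h, h']
  | single μ x =>
    induction Y using skew_induction with
    | zero => simp [dagger_zero]
    | add Y Y' h h' => rw [mul_add, dagger_add, dagger_add, add_mul, h, h']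
    | single ν y => simp [dagger_single, mul_smul, mul_comm]

lemma dagger_dagger (X : SkewMonoidAlgebra L N) : dagger (dagger X) = X := by
  induction X using skew_induction with
  | zero => simp [dagger_zero]
  | add X X' h h' => rw [dagger_add, dagger_add, h, h']
  | single μ x => simp [dagger_single]

lemma coeff_dagger (X : SkewMonoidAlgebra L N) (μ : N) :
    (dagger X).coeff μ = μ • X.coeff μ⁻¹ := by
  classical
  induction X using skew_induction with
  | zero => simp [dagger_zero]
  | add X X' h h' => rw [dagger_add, coeff_add, coeff_add, Finsupp.add_apply, Finsupp.add_apply,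
      h, h', smul_add]
  | single ν x =>
    rw [dagger_single, coeff_single_apply, coeff_single_apply]
    by_cases h : ν⁻¹ = μ
    · subst h; simp
    · rw [if_neg h, if_neg (fun h' => h (by rw [h', inv_inv])), smul_zero]

lemma mem_support_dagger {X : SkewMonoidAlgebra L N} {μ : N} :
    μ ∈ (dagger X).support ↔ μ⁻¹ ∈ X.support := by
  rw [mem_support_iff, mem_support_iff, coeff_dagger, Ne, smul_eq_zero_iff_eq]

/-- The image of a subring of `L ∗ N` under the anti-automorphism `†`. -/
def daggerSubring (U : Subring (SkewMonoidAlgebra L N)) : Subring (SkewMonoidAlgebra L N) where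
  carrier := {X | dagger X ∈ U}
  zero_mem' := by simp [dagger_zero, U.zero_mem]
  one_mem' := by simp [dagger_one, U.one_mem]
  add_mem' h h' := by
    rw [Set.mem_ofPred_eq, dagger_add]
    exact U.add_mem h h'
  neg_mem' h := by
    rw [Set.mem_ofPred_eq, dagger_neg]
    exact U.neg_mem h
  mul_mem' h h' := by
    rw [Set.mem_ofPred_eq, dagger_mul]
    exact U.mul_mem h' h

lemma mem_daggerSubring {U : Subring (SkewMonoidAlgebra L N)} {X : SkewMonoidAlgebra L N} :
    X ∈ daggerSubring U ↔ dagger X ∈ U := Iff.rfl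

end SkewBasics

/-! #### The action of `G` -/

/-- The actions of `G` on `N` and on `L` are compatible: `G` acts on `N` by automorphisms and
`g (μ a) = ᵍμ (g a)`. -/
structure CompatibleActions (G N L : Type*) [Group G] [Group N] [Field L] [MulSemiringAction N L]
    [MulSemiringAction G L] [MulAction G N] : Prop where
  smul_mul : ∀ (g : G) (μ ν : N), g • (μ * ν) = g • μ * g • ν
  smul_smul : ∀ (g : G) (μ : N) (a : L), g • μ • a = (g • μ) • g • a

section SkewAction

variable {G L N : Type*} [Field L] [Group N] [MulSemiringAction N L] [Group G]
  [MulSemiringAction G L] [MulAction G N]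

lemma CompatibleActions.smul_one (hc : CompatibleActions G N L) (g : G) : g • (1 : N) = 1 := by
  have h := hc.smul_mul g 1 1
  rw [one_mul] at h
  exact left_eq_mul.1 h

lemma CompatibleActions.smul_inv (hc : CompatibleActions G N L) (g : G) (μ : N) :
    g • μ⁻¹ = (g • μ)⁻¹ := by
  rw [eq_inv_iff_mul_eq_one, ← hc.smul_mul, inv_mul_cancel, hc.smul_one]

lemma skewAct_single (g : G) (μ : N) (x : L) :
    skewAct g (single μ x) = single (g • μ) (g • x) :=
  sum_single_index (by simp)

lemma skewAct_zero (g : G) : skewAct g (0 : SkewMonoidAlgebra L N) = 0 :=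
  sum_zero_index

lemma skewAct_add (g : G) (X Y : SkewMonoidAlgebra L N) :
    skewAct g (X + Y) = skewAct g X + skewAct g Y :=
  sum_add_index' (by simp) (by intros; rw [smul_add, single_add])

lemma skewAct_neg (g : G) (X : SkewMonoidAlgebra L N) : skewAct g (-X) = -skewAct g X := by
  rw [eq_neg_iff_add_eq_zero, ← skewAct_add, neg_add_cancel, skewAct_zero]

lemma coeff_skewAct (g : G) (X : SkewMonoidAlgebra L N) (μ : N) :
    (skewAct g X).coeff (g • μ) = g • X.coeff μ := by
  classical
  induction X using skew_induction with
  | zero => simp [skewAct_zero]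
  | add X X' h h' => rw [skewAct_add, coeff_add, coeff_add, Finsupp.add_apply, Finsupp.add_apply,
      h, h', smul_add]
  | single ν x =>
    rw [skewAct_single, coeff_single_apply, coeff_single_apply]
    simp only [smul_left_cancel_iff]
    split_ifs <;> simp

variable (hc : CompatibleActions G N L)
include hc

lemma skewAct_one (g : G) : skewAct g (1 : SkewMonoidAlgebra L N) = 1 := by
  rw [one_def, skewAct_single, hc.smul_one, MulSemiringAction.smul_one]

lemma skewAct_mul (g : G) (X Y : SkewMonoidAlgebra L N) :
    skewAct g (X * Y) = skewAct g X * skewAct g Y := by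
  induction X using skew_induction with
  | zero => simp [skewAct_zero]
  | add X X' h h' => rw [add_mul, skewAct_add, skewAct_add, add_mul, h, h']
  | single μ x =>
    induction Y using skew_induction with
    | zero => simp [skewAct_zero]
    | add Y Y' h h' => rw [mul_add, skewAct_add, skewAct_add, mul_add, h, h']
    | single ν y => simp [skewAct_single, hc.smul_mul, hc.smul_smul]

lemma skewAct_dagger (g : G) (X : SkewMonoidAlgebra L N) :
    skewAct g (dagger X) = dagger (skewAct g X) := by
  induction X using skew_induction with
  | zero => simp [dagger_zero, skewAct_zero]
  | add X X' h h' => rw [dagger_add, skewAct_add, skewAct_add, dagger_add, h, h']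
  | single μ x => simp [dagger_single, skewAct_single, hc.smul_smul, hc.smul_inv]

/-- With `X` and `a` both `G`-invariant, this makes `X(a)` invariant. -/
lemma smul_evaluation (g : G) (X : SkewMonoidAlgebra L N) (a : L) :
    g • evaluation X a = evaluation (skewAct g X) (g • a) := by
  induction X using skew_induction with
  | zero => simp [evaluation_zero_left, skewAct_zero]
  | add X X' h h' => rw [evaluation_add_left, smul_add, skewAct_add, evaluation_add_left, h, h']
  | single μ x => simp [evaluation_single, skewAct_single, hc.smul_smul]

/-- The invariants `(L ∗ M)^G`, as a subring of `L ∗ N`. -/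
def invariantSubring (M : Submonoid N) : Subring (SkewMonoidAlgebra L N) where
  carrier := invariants G L M
  zero_mem' := ⟨by simp, fun g => skewAct_zero g⟩
  one_mem' := by
    classical
    refine ⟨fun μ hμ => ?_, fun g => skewAct_one hc g⟩
    rw [one_def, mem_support_iff, coeff_single_apply] at hμ
    rw [← (ite_ne_right_iff.1 hμ).1]
    exact M.one_mem
  add_mem' := by
    classical
    intro X Y hX hY
    refine ⟨fun μ hμ => ?_, fun g => by rw [skewAct_add, hX.2, hY.2]⟩
    rcases Finset.mem_union.1 (support_add hμ) with h | h
    exacts [hX.1 μ h, hY.1 μ h]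
  neg_mem' := by
    intro X hX
    refine ⟨fun μ hμ => hX.1 μ ?_, fun g => by rw [skewAct_neg, hX.2]⟩
    rw [mem_support_iff] at hμ ⊢
    simpa using hμ
  mul_mem' := by
    intro X Y hX hY
    refine ⟨fun μ hμ => ?_, fun g => by rw [skewAct_mul hc, hX.2, hY.2]⟩
    rw [mem_support_iff, coeff_mul_left, sum_def'] at hμ
    obtain ⟨ν, hν, h⟩ := Finset.exists_ne_zero_of_sum_ne_zero hμ
    have h2 : Y.coeff (ν⁻¹ * μ) ≠ 0 := fun h0 => h (by simp [h0])
    simpa using M.mul_mem (hX.1 ν hν) (hY.1 _ (mem_support_iff.2 h2))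

lemma single_one_mem_invariants (M : Submonoid N) {x : L} (hx : ∀ g : G, g • x = x) :
    single 1 x ∈ invariants G L M := by
  classical
  refine ⟨fun μ hμ => ?_, fun g => by rw [skewAct_single, hc.smul_one, hx]⟩
  rw [mem_support_iff, coeff_single_apply] at hμ
  rw [← (ite_ne_right_iff.1 hμ).1]
  exact M.one_mem

end SkewAction

end GaloisOrder

namespace GaloisOrder

open SkewMonoidAlgebra

set_option linter.unusedSectionVars false

/-! ### Independence of the elements of `N` as characters of `Γ` -/

section Characters

variable {G L N : Type*} [Field L] [Group N] [MulSemiringAction N L] [Group G]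
  [MulSemiringAction G L] {Λ : Subring L}

/-- The character of the multiplicative monoid `Γ = Λ^G` with values in `L` defined by `μ ∈ N`. -/
def baseCharacter (G : Type*) [Group G] [MulSemiringAction G L] (Λ : Subring L) (μ : N) :
    invariantBase G Λ →* L where
  toFun r := μ • (r : L)
  map_one' := by simp
  map_mul' := by simp

lemma baseCharacter_injective (hsep : ∀ μ : N, (∀ r ∈ invariantBase G Λ, μ • r = r) → μ = 1) :
    Function.Injective (baseCharacter G Λ : N → invariantBase G Λ →* L) := by
  intro μ ν h
  have h1 := hsep (ν⁻¹ * μ) fun r hr => by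
    have h2 : μ • r = ν • r := DFunLike.congr_fun h ⟨r, hr⟩
    rw [mul_smul, h2, inv_smul_smul]
  exact (inv_mul_eq_one.1 h1).symm

/-- Dedekind's independence of characters, applied to the multiplicative monoid of `Γ`. -/
lemma linearIndependent_baseCharacter
    (hsep : ∀ μ : N, (∀ r ∈ invariantBase G Λ, μ • r = r) → μ = 1) (F : Finset N) :
    LinearIndependent L fun (μ : F) (r : invariantBase G Λ) => (μ : N) • (r : L) :=
  (linearIndependent_monoidHom (invariantBase G Λ) L).comp
    (fun μ : F => baseCharacter G Λ (μ : N))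
    ((baseCharacter_injective hsep).comp Subtype.val_injective)

/-- Row rank equals column rank for the matrix `(μ(r))`: independence of the finitely many functions
indexed by `F` means that the vectors indexed by `r` span. -/
lemma span_baseCharacter
    (hsep : ∀ μ : N, (∀ r ∈ invariantBase G Λ, μ • r = r) → μ = 1) (F : Finset N) :
    Submodule.span L (Set.range fun (r : invariantBase G Λ) (μ : F) => (μ : N) • (r : L)) = ⊤ :=
  span_flip_eq_top_iff_linearIndependent.2 (linearIndependent_baseCharacter hsep F)

lemma exists_sum_ne_zero (hsep : ∀ μ : N, (∀ r ∈ invariantBase G Λ, μ • r = r) → μ = 1)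
    (F : Finset N) (c : N → L) {ν : N} (hν : ν ∈ F) (hc : c ν ≠ 0) :
    ∃ r ∈ invariantBase G Λ, ∑ μ ∈ F, c μ * μ • r ≠ 0 := by
  by_contra! h
  refine hc (Fintype.linearIndependent_iff.1 (linearIndependent_baseCharacter hsep F)
    (fun μ => c μ) ?_ ⟨ν, hν⟩)
  ext r
  simpa [Finset.sum_attach F fun μ => c μ * μ • (r : L)] using h r r.2

end Characters

/-! ### Galois rings: supports, averaging and `K U = 𝒦 = U K` -/

section Ring

variable {G L N : Type*} [Field L] [Group N] [MulSemiringAction N L] [Group G]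
  [MulSemiringAction G L] {Λ : Subring L}
  {U : Subring (SkewMonoidAlgebra L N)}

lemma single_mem_baseRing {r : L} (hr : r ∈ invariantBase G Λ) : single 1 r ∈ baseRing G N Λ :=
  ⟨r, hr, rfl⟩

lemma mem_baseField {X : SkewMonoidAlgebra L N} :
    X ∈ baseField (G := G) L N ↔ ∃ r : L, (∀ g : G, g • r = r) ∧ single 1 r = X := Iff.rfl

lemma smul_eq_single_mul (l : L) (X : SkewMonoidAlgebra L N) : l • X = single 1 l * X := by
  ext μ
  simp

/-- In `X Y` the coefficient at `μ ν` may cancel. In `X r Y` with `r ∈ Γ` it becomes a combination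
of the values `ξ(r)` whose coefficient at `ξ = μ` is non-zero, so independence supplies an `r` for
which it survives. -/
lemma exists_mem_support_mul
    (hsep : ∀ μ : N, (∀ r ∈ invariantBase G Λ, μ • r = r) → μ = 1)
    (hU : baseRing G N Λ ≤ U) {X Y : SkewMonoidAlgebra L N} (hX : X ∈ U) (hY : Y ∈ U) {μ ν : N}
    (hμ : μ ∈ X.support) (hν : ν ∈ Y.support) : ∃ Z ∈ U, μ * ν ∈ Z.support := by
  obtain ⟨r, hr, h⟩ := exists_sum_ne_zero hsep X.support
    (fun ξ => X.coeff ξ * ξ • Y.coeff (ξ⁻¹ * (μ * ν))) hμ (by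
      rw [inv_mul_cancel_left]
      refine mul_ne_zero (mem_support_iff.1 hμ) ?_
      rw [Ne, smul_eq_zero_iff_eq]
      exact mem_support_iff.1 hν)
  refine ⟨X * (single 1 r * Y), U.mul_mem hX (U.mul_mem (hU (single_mem_baseRing hr)) hY), ?_⟩
  rw [mem_support_iff, coeff_mul_left, sum_def']
  refine ne_of_eq_of_ne (Finset.sum_congr rfl fun ξ _ => ?_) h
  rw [coeff_single_one_mul, smul_mul']
  ring

lemma exists_mem_support_of_mem_closure
    (hsep : ∀ μ : N, (∀ r ∈ invariantBase G Λ, μ • r = r) → μ = 1)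
    (hU : baseRing G N Λ ≤ U) {𝒳 : Set (SkewMonoidAlgebra L N)} (h𝒳 : 𝒳 ⊆ U) {μ : N}
    (hμ : μ ∈ Submonoid.closure (⋃ X ∈ 𝒳, (X.support : Set N))) :
    ∃ X ∈ U, μ ∈ X.support := by
  classical
  induction hμ using Submonoid.closure_induction with
  | mem μ h =>
    obtain ⟨X, hX, hμ⟩ := Set.mem_iUnion₂.1 h
    exact ⟨X, h𝒳 hX, hμ⟩
  | one => exact ⟨1, U.one_mem, by rw [mem_support_iff, one_def, coeff_single_apply]; simp⟩
  | mul μ ν _ _ h h' =>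
    obtain ⟨X, hX, hμ⟩ := h
    obtain ⟨Y, hY, hν⟩ := h'
    exact exists_mem_support_mul hsep hU hX hY hμ hν

/-- Right multiplication by `r ∈ Γ` scales the coefficient of `X` at `ν` by `ν(r)`. These scaling
vectors span `L ^ supp X`, so `L`-combinations of the elements `X r` realize every rescaling, in
particular the one that kills all terms but one. -/
lemma single_mem_span
    (hsep : ∀ μ : N, (∀ r ∈ invariantBase G Λ, μ • r = r) → μ = 1)
    (hU : baseRing G N Λ ≤ U) {X : SkewMonoidAlgebra L N} (hX : X ∈ U) {μ : N}
    (hμ : μ ∈ X.support) (a : L) :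
    single μ a ∈ Submodule.span L (U : Set (SkewMonoidAlgebra L N)) := by
  classical
  have key : ∀ w : X.support → L, ∑ ν : X.support, single (ν : N) (w ν * X.coeff ν) ∈
      Submodule.span L (U : Set (SkewMonoidAlgebra L N)) := by
    intro w
    have hw : w ∈ Submodule.span L (Set.range fun (r : invariantBase G Λ) (μ : X.support) =>
        (μ : N) • (r : L)) := by
      rw [span_baseCharacter hsep]
      trivial
    induction hw using Submodule.span_induction with
    | zero => simp
    | add w w' _ _ h h' =>
      simp only [Pi.add_apply, add_mul, single_add, Finset.sum_add_distrib]
      exact Submodule.add_mem _ h h'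
    | smul l w _ h =>
      have : ∑ ν : X.support, single (ν : N) ((l • w) ν * X.coeff ν) =
          l • ∑ ν : X.support, single (ν : N) (w ν * X.coeff ν) := by
        rw [Finset.smul_sum]
        refine Finset.sum_congr rfl fun ν _ => ?_
        rw [SkewMonoidAlgebra.smul_single, Pi.smul_apply, smul_eq_mul, smul_eq_mul, mul_assoc]
      rw [this]
      exact Submodule.smul_mem _ _ h
    | mem w hw =>
      obtain ⟨r, rfl⟩ := hw
      refine Submodule.subset_span ?_
      have : ∑ ν : X.support, single (ν : N) ((ν : N) • (r : L) * X.coeff ν) =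
          X * single 1 (r : L) := by
        rw [Finset.sum_coe_sort X.support fun ν => single ν (ν • (r : L) * X.coeff ν)]
        conv_rhs => rw [← sum_single X, sum_mul, sum_def']
        refine Finset.sum_congr rfl fun ν _ => ?_
        rw [single_mul_single, mul_one, mul_comm]
      rw [this]
      exact U.mul_mem hX (hU (single_mem_baseRing r.2))
  -- The weight is supported at `μ` and replaces the coefficient there by `a`.
  have h := key (Pi.single ⟨μ, hμ⟩ (a * (X.coeff μ)⁻¹))
  rw [Finset.sum_eq_single ⟨μ, hμ⟩ (fun ν _ hν => by simp [hν]) (by simp)] at h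
  simpa [mul_assoc, inv_mul_cancel₀ (mem_support_iff.1 hμ)] using h

lemma mul_mem_productSpan {K : Subring (SkewMonoidAlgebra L N)} {c X : SkewMonoidAlgebra L N}
    (hc : c ∈ K) (hX : X ∈ productSpan K U) : c * X ∈ productSpan K U := by
  induction hX using AddSubgroup.closure_induction with
  | mem X hX =>
    obtain ⟨b, hb, u, hu, rfl⟩ := hX
    exact AddSubgroup.subset_closure ⟨c * b, K.mul_mem hc hb, u, hu, (mul_assoc _ _ _).symm⟩
  | zero => simp
  | add X Y _ _ h h' =>
    rw [mul_add]
    exact add_mem h h'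
  | neg X _ h =>
    rw [mul_neg]
    exact neg_mem h

variable [MulAction G N] [Finite G] (hc : CompatibleActions G N L)
include hc

/-- Elements of `U` are invariant, so averaging `∑ f_i u_i` only replaces each `f_i` by its trace,
which lies in `K`. -/
lemma sum_skewAct_mem_productSpan [Fintype G] (hinv : ∀ X ∈ U, ∀ g : G, skewAct g X = X)
    {Y : SkewMonoidAlgebra L N}
    (hY : Y ∈ Submodule.span L (U : Set (SkewMonoidAlgebra L N))) :
    ∑ g : G, skewAct g Y ∈ productSpan (baseField (G := G) L N) U := by
  rw [Submodule.mem_span_set'] at hY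
  obtain ⟨n, f, u, rfl⟩ := hY
  have h : ∀ g : G, skewAct g (∑ i, f i • (u i : SkewMonoidAlgebra L N)) =
      ∑ i, (single 1 (g • f i) * (u i : SkewMonoidAlgebra L N)) := by
    intro g
    let φ : SkewMonoidAlgebra L N →+ SkewMonoidAlgebra L N :=
      { toFun := skewAct g, map_zero' := skewAct_zero g, map_add' := skewAct_add g }
    refine (_root_.map_sum φ _ _).trans (Finset.sum_congr rfl fun i _ => ?_)
    change skewAct g _ = _
    rw [smul_eq_single_mul, skewAct_mul hc, skewAct_single, hc.smul_one, hinv _ (u i).2]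
  simp only [h]
  rw [Finset.sum_comm]
  refine sum_mem fun i _ => AddSubgroup.subset_closure
    ⟨single 1 (∑ g : G, g • f i), ?_, u i, (u i).2, ?_⟩
  · refine mem_baseField.2 ⟨_, fun g => ?_, rfl⟩
    rw [Finset.smul_sum]
    simp only [← mul_smul]
    exact Fintype.sum_bijective _ (Group.mulLeft_bijective g) _ _ fun _ => rfl
  · rw [← Finset.sum_mul]
    congr 1
    exact (_root_.map_sum (singleAddHom (1 : N)) (fun g : G => g • f i) _).symm

/-- An invariant `Y` has trace `|G| Y`, and `|G|` is invertible in `K`. -/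
lemma mem_productSpan_baseField
    (hcard : (Nat.card G : L) ≠ 0)
    (hsep : ∀ μ : N, (∀ r ∈ invariantBase G Λ, μ • r = r) → μ = 1)
    (hU : baseRing G N Λ ≤ U) (hinv : ∀ X ∈ U, ∀ g : G, skewAct g X = X)
    {Y : SkewMonoidAlgebra L N} (hY : ∀ g : G, skewAct g Y = Y)
    (hsupp : ∀ μ ∈ Y.support, ∃ X ∈ U, μ ∈ X.support) :
    Y ∈ productSpan (baseField (G := G) L N) U := by
  have := Fintype.ofFinite G
  have hspan : Y ∈ Submodule.span L (U : Set (SkewMonoidAlgebra L N)) := by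
    rw [← sum_single Y, sum_def']
    refine sum_mem fun μ hμ => ?_
    obtain ⟨X, hX, h⟩ := hsupp μ hμ
    exact single_mem_span hsep hU hX h _
  have h := sum_skewAct_mem_productSpan hc hinv hspan
  simp only [hY, Finset.sum_const, Finset.card_univ, ← Nat.card_eq_fintype_card] at h
  have h2 := mul_mem_productSpan (c := single 1 (Nat.card G : L)⁻¹)
    (mem_baseField.2 ⟨_, fun g => by
      simp [show g • (Fintype.card G : L) = _ from
        map_natCast (MulSemiringAction.toRingHom G L g) _], rfl⟩) h
  rwa [nsmul_eq_mul, ← single_nat, ← mul_assoc, single_mul_single, one_smul, mul_one,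
    inv_mul_cancel₀ hcard, single_one_one, one_mul] at h2

/-- A subring of `(L ∗ M)^G` containing `Γ` in which every element of `M` occurs in the support of
some element is a Galois `Γ`-ring. -/
lemma isGaloisRing_of_support {M : Submonoid N} (hcard : (Nat.card G : L) ≠ 0)
    (hsep : ∀ μ : N, (∀ r ∈ invariantBase G Λ, μ • r = r) → μ = 1)
    (hU : baseRing G N Λ ≤ U) (hinv : (U : Set (SkewMonoidAlgebra L N)) ⊆ invariants G L M)
    (hsupp : ∀ μ ∈ M, ∃ X ∈ U, μ ∈ X.support) :
    IsGaloisRing (baseRing G N Λ) (baseField (G := G) L N) (invariants G L M) U := by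
  have hK : (baseField (G := G) L N : Set (SkewMonoidAlgebra L N)) ⊆ invariants G L M := by
    rintro _ ⟨x, hx, rfl⟩
    exact single_one_mem_invariants hc M hx
  have hle : ∀ B C : Subring (SkewMonoidAlgebra L N),
      (B : Set (SkewMonoidAlgebra L N)) ⊆ invariants G L M →
      (C : Set (SkewMonoidAlgebra L N)) ⊆ invariants G L M →
      (productSpan B C : Set (SkewMonoidAlgebra L N)) ⊆ invariants G L M := by
    intro B C hB hC
    refine (AddSubgroup.closure_le (invariantSubring hc M).toAddSubgroup).2 ?_
    rintro _ ⟨b, hb, c, hc', rfl⟩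
    exact (invariantSubring hc M).mul_mem (hB hb) (hC hc')
  refine ⟨hU, hinv, (hle _ _ hinv hK).antisymm fun Y hY => ?_,
    (hle _ _ hK hinv).antisymm fun Y hY => ?_⟩
  -- The right-hand equality follows from the left-hand argument for `U†`: `†` reverses products,
  -- fixes `K` pointwise and commutes with `G`.
  · have h : dagger Y ∈ productSpan (baseField (G := G) L N) (daggerSubring U) := by
      refine mem_productSpan_baseField hc hcard hsep ?_ (fun X hX g => ?_) (fun g => ?_)
        fun μ hμ => ?_
      · rintro _ ⟨r, hr, rfl⟩
        rw [mem_daggerSubring]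
        change dagger (single 1 r) ∈ U
        rw [dagger_single_one]
        exact hU (single_mem_baseRing hr)
      · rw [← dagger_dagger X, skewAct_dagger hc, (hinv hX).2]
      · rw [skewAct_dagger hc, hY.2]
      · obtain ⟨X, hX, h⟩ := hsupp _ (hY.1 _ (mem_support_dagger.1 hμ))
        refine ⟨dagger X, ?_, mem_support_dagger.2 h⟩
        rwa [mem_daggerSubring, dagger_dagger]
    have h2 : ∀ Z ∈ productSpan (baseField (G := G) L N) (daggerSubring U),
        dagger Z ∈ productSpan U (baseField (G := G) L N) := by
      intro Z hZ
      induction hZ using AddSubgroup.closure_induction with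
      | mem Z hZ =>
        obtain ⟨b, ⟨r, hr, rfl⟩, u, hu, rfl⟩ := hZ
        refine AddSubgroup.subset_closure ⟨_, hu, _, ⟨r, hr, rfl⟩, ?_⟩
        rw [dagger_mul]
        exact congrArg _ (dagger_single_one r)
      | zero => simp [dagger_zero]
      | add X Y _ _ h h' =>
        rw [dagger_add]
        exact add_mem h h'
      | neg X _ h =>
        rw [dagger_neg]
        exact neg_mem h
    simpa [dagger_dagger] using h2 _ h
  · exact mem_productSpan_baseField hc hcard hsep hU (fun X hX => (hinv hX).2) hY.2
      fun μ hμ => hsupp μ (hY.1 μ hμ)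

end Ring

end GaloisOrder

namespace GaloisOrder

open SkewMonoidAlgebra

set_option linter.unusedSectionVars false

/-! ### Common denominators and finiteness of `W ∩ U` -/

section Order

variable {G L N : Type*} [Field L] [Group N] [MulSemiringAction N L] [Group G]
  [MulSemiringAction G L] {Λ : Subring L}
  {U : Subring (SkewMonoidAlgebra L N)}

/-- The elements of `U` with support in a given finite set have a common denominator in `Λ`. -/
def HasBoundedDenominators (Λ : Subring L) (U : Set (SkewMonoidAlgebra L N)) : Prop :=
  ∀ F : Finset N, ∃ δ ∈ Λ, δ ≠ 0 ∧ ∀ X ∈ U, X.support ⊆ F → ∀ μ, δ * X.coeff μ ∈ Λ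

/-- The vectors `w` with such a `δ` form an `L`-subspace. It contains each `(μ(r))_μ`, where the sum
is `X(r)` and `δ = 1` works, hence it is all of `L ^ F`. The point is that `δ` does not depend on
`X`. -/
lemma exists_denominator (hfrac : ∀ l : L, ∃ b ∈ Λ, b ≠ 0 ∧ b * l ∈ Λ)
    (hsep : ∀ μ : N, (∀ r ∈ invariantBase G Λ, μ • r = r) → μ = 1) (F : Finset N)
    (w : F → L) : ∃ δ ∈ Λ, δ ≠ 0 ∧ ∀ X : SkewMonoidAlgebra L N, X.support ⊆ F →
      (∀ r ∈ invariantBase G Λ, evaluation X r ∈ Λ) → δ * ∑ μ : F, X.coeff μ * w μ ∈ Λ := by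
  have hw : w ∈ Submodule.span L (Set.range fun (r : invariantBase G Λ) (μ : F) =>
      (μ : N) • (r : L)) := by
    rw [span_baseCharacter hsep]
    trivial
  induction hw using Submodule.span_induction with
  | zero => exact ⟨1, Λ.one_mem, one_ne_zero, fun X _ _ => by simp [Λ.zero_mem]⟩
  | add w w' _ _ h h' =>
    obtain ⟨δ, hδ, h0, h⟩ := h
    obtain ⟨δ', hδ', h0', h'⟩ := h'
    refine ⟨δ * δ', Λ.mul_mem hδ hδ', mul_ne_zero h0 h0', fun X hX hev => ?_⟩
    convert Λ.add_mem (Λ.mul_mem hδ' (h X hX hev)) (Λ.mul_mem hδ (h' X hX hev)) using 1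
    simp only [Pi.add_apply, mul_add, Finset.sum_add_distrib]
    ring
  | smul l w _ h =>
    obtain ⟨δ, hδ, h0, h⟩ := h
    obtain ⟨b, hb, hb0, hbl⟩ := hfrac l
    refine ⟨b * δ, Λ.mul_mem hb hδ, mul_ne_zero hb0 h0, fun X hX hev => ?_⟩
    convert Λ.mul_mem hbl (h X hX hev) using 1
    simp only [Pi.smul_apply, smul_eq_mul, Finset.mul_sum]
    exact Finset.sum_congr rfl fun _ _ => by ring
  | mem w hw =>
    obtain ⟨r, rfl⟩ := hw
    refine ⟨1, Λ.one_mem, one_ne_zero, fun X hX hev => ?_⟩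
    rw [one_mul, Finset.sum_coe_sort F fun μ => X.coeff μ * μ • (r : L),
      ← evaluation_eq_sum hX]
    exact hev r r.2

lemma hasBoundedDenominators_of_evaluation (hfrac : ∀ l : L, ∃ b ∈ Λ, b ≠ 0 ∧ b * l ∈ Λ)
    (hsep : ∀ μ : N, (∀ r ∈ invariantBase G Λ, μ • r = r) → μ = 1)
    {U : Set (SkewMonoidAlgebra L N)}
    (hU : ∀ X ∈ U, ∀ r ∈ invariantBase G Λ, evaluation X r ∈ Λ) :
    HasBoundedDenominators Λ U := by
  classical
  intro F
  -- The standard basis vectors extract the individual coefficients; the product of their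
  -- denominators serves all at once.
  choose δ hδ h0 h using fun ν : F => exists_denominator hfrac hsep F (Pi.single ν 1)
  refine ⟨∏ ν, δ ν, prod_mem fun ν _ => hδ ν, Finset.prod_ne_zero_iff.2 fun ν _ => h0 ν,
    fun X hX hs μ => ?_⟩
  by_cases hμ : μ ∈ F
  · have h1 := h ⟨μ, hμ⟩ X hs (hU X hX)
    rw [Finset.sum_eq_single ⟨μ, hμ⟩ (fun ν _ hν => by simp [hν]) (by simp), Pi.single_eq_same,
      mul_one] at h1
    rw [← Finset.prod_erase_mul _ _ (Finset.mem_univ (⟨μ, hμ⟩ : F)), mul_assoc]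
    exact Λ.mul_mem (prod_mem fun ν _ => hδ ν) h1
  · rw [notMem_support_iff.1 fun h => hμ (hs h), mul_zero]
    exact Λ.zero_mem

/-- Written as `∑ μ y_μ`, the element `X` has right-hand coefficients `y_μ = μ⁻¹(x_μ)`. If `δ`
clears the `x_μ`, then `μ⁻¹(δ)` clears `y_μ`, so the product over `F` clears them all. -/
lemma exists_denominator_dagger (hN : ∀ μ : N, ∀ a ∈ Λ, μ • a ∈ Λ) {U : Set (SkewMonoidAlgebra L N)}
    (hden : HasBoundedDenominators Λ U) (F : Finset N) :
    ∃ δ ∈ Λ, δ ≠ 0 ∧ ∀ X ∈ U, X.support ⊆ F → ∀ μ, δ * (μ⁻¹ • X.coeff μ) ∈ Λ := by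
  classical
  obtain ⟨δ, hδ, h0, h⟩ := hden F
  refine ⟨∏ ν ∈ F, ν⁻¹ • δ, prod_mem fun ν _ => hN _ _ hδ,
    Finset.prod_ne_zero_iff.2 fun ν _ => by rwa [Ne, smul_eq_zero_iff_eq],
    fun X hX hs μ => ?_⟩
  by_cases hμ : μ ∈ F
  · rw [← Finset.prod_erase_mul _ _ hμ, mul_assoc, ← smul_mul']
    exact Λ.mul_mem (prod_mem fun ν _ => hN _ _ hδ) (hN _ _ (h X hX hs μ))
  · rw [notMem_support_iff.1 fun h => hμ (hs h), smul_zero, mul_zero]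
    exact Λ.zero_mem

lemma HasBoundedDenominators.of_dagger (hN : ∀ μ : N, ∀ a ∈ Λ, μ • a ∈ Λ)
    {U : Set (SkewMonoidAlgebra L N)} (hden : HasBoundedDenominators Λ (dagger ⁻¹' U)) :
    HasBoundedDenominators Λ U := by
  classical
  intro F
  obtain ⟨δ, hδ, h0, h⟩ := exists_denominator_dagger hN hden (F.image (·⁻¹))
  refine ⟨δ, hδ, h0, fun X hX hs μ => ?_⟩
  have h1 := h (dagger X) (by rwa [Set.mem_preimage, dagger_dagger]) (fun ν hν =>
    Finset.mem_image.2 ⟨ν⁻¹, hs (mem_support_dagger.1 hν), inv_inv ν⟩) μ⁻¹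
  rwa [coeff_dagger, inv_inv, smul_smul, mul_inv_cancel, one_smul] at h1

/-- Scalars do not enlarge supports, so the union of the supports of finitely many generators
suffices. -/
lemma exists_finset_support_of_fg {K : Type*} [Ring K] [Module K (SkewMonoidAlgebra L N)]
    (hK : ∀ (c : K) (X : SkewMonoidAlgebra L N), (c • X).support ⊆ X.support)
    {W : Submodule K (SkewMonoidAlgebra L N)} (hW : W.FG) :
    ∃ F : Finset N, ∀ X ∈ W, X.support ⊆ F := by
  classical
  obtain ⟨S, rfl⟩ := hW
  refine ⟨S.biUnion support, fun X hX => ?_⟩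
  induction hX using Submodule.span_induction with
  | mem X hX => exact Finset.subset_biUnion_of_mem support hX
  | zero => simp
  | add X Y _ _ h h' => exact support_add.trans (Finset.union_subset h h')
  | smul c X _ h => exact (hK c X).trans h

/-- `Γ` as a ring acting on `L ∗ N` on the left. -/
noncomputable def toBaseRing (N : Type*) [Group N] [MulSemiringAction N L] (Λ : Subring L) :
    invariantBase G Λ →+* baseRing G N Λ :=
  (singleOneRingHom.comp (invariantBase G Λ).subtype).codRestrict _
    fun r => single_mem_baseRing r.2

/-- `Γ` as a ring acting on `L ∗ N` on the right. -/
noncomputable def toBaseRingOp (N : Type*) [Group N] [MulSemiringAction N L] (Λ : Subring L) :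
    invariantBase G Λ →+* (baseRing G N Λ).op where
  toFun r := ⟨MulOpposite.op (single 1 (r : L)), single_mem_baseRing r.2⟩
  map_one' := rfl
  map_zero' := by
    ext
    simp
  map_add' r s := by
    ext : 1
    simp [single_add]
  map_mul' r s := by
    ext : 1
    simp [← MulOpposite.op_mul, mul_comm]

instance toBaseRing_surjective : RingHomSurjective (toBaseRing (G := G) N Λ) := by
  refine ⟨?_⟩
  rintro ⟨_, r, hr, rfl⟩
  exact ⟨⟨r, hr⟩, rfl⟩

instance toBaseRingOp_surjective : RingHomSurjective (toBaseRingOp (G := G) N Λ) := by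
  refine ⟨?_⟩
  rintro ⟨_, r, hr, h⟩
  exact ⟨⟨r, hr⟩, Subtype.ext (congrArg MulOpposite.op h)⟩

/-- The map `(a_μ) ↦ ∑ c a_μ μ` from `Λ^F` to `L ∗ N`. -/
noncomputable def leftFamily (F : Finset N) (c : L) :
    (F → asBaseModule G Λ) →ₛₗ[toBaseRing (G := G) N Λ] SkewMonoidAlgebra L N where
  toFun a := ∑ μ : F, single (μ : N) (c * (a μ : L))
  map_add' a b := by simp [mul_add, single_add, Finset.sum_add_distrib]
  map_smul' r a := by
    rw [Finset.smul_sum]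
    refine Finset.sum_congr rfl fun μ _ => ?_
    refine Eq.trans ?_ (single_mul_single (a₁ := (1 : N)) (b₁ := (r : L))).symm
    rw [one_mul, one_smul]
    congr 1
    exact mul_left_comm _ _ _

/-- The map `(a_μ) ↦ ∑ μ c a_μ` from `Λ^F` to `L ∗ N`. -/
noncomputable def rightFamily (F : Finset N) (c : L) :
    (F → asBaseModule G Λ) →ₛₗ[toBaseRingOp (G := G) N Λ] SkewMonoidAlgebra L N where
  toFun a := ∑ μ : F, single (μ : N) ((μ : N) • (c * (a μ : L)))
  map_add' a b := by simp [mul_add, single_add, Finset.sum_add_distrib]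
  map_smul' r a := by
    rw [Finset.smul_sum]
    refine Finset.sum_congr rfl fun μ _ => ?_
    refine Eq.trans ?_ (single_mul_single (a₂ := (1 : N)) (b₂ := (r : L))).symm
    rw [mul_one, ← smul_mul']
    congr 2
    rw [mul_assoc]
    congr 1
    exact mul_comm _ _

lemma isFGLeft_inter [IsNoetherian (invariantBase G Λ) (asBaseModule G Λ)]
    (hU : baseRing G N Λ ≤ U) (hden : HasBoundedDenominators Λ (U : Set (SkewMonoidAlgebra L N)))
    (W : Submodule (baseField (G := G) L N) (SkewMonoidAlgebra L N)) (hW : W.FG) :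
    IsFGLeft (baseRing G N Λ)
      ((W : Set (SkewMonoidAlgebra L N)) ∩ (U : Set (SkewMonoidAlgebra L N))) := by
  obtain ⟨F, hF⟩ := exists_finset_support_of_fg (fun c X μ hμ => by
    obtain ⟨_, r, hr, rfl⟩ := c
    rw [mem_support_iff] at hμ ⊢
    intro h
    exact hμ ((coeff_single_one_mul X r μ).trans (by rw [h, mul_zero]))) hW
  obtain ⟨δ, hδ, h0, h⟩ := hden F
  let Q : Submodule (baseRing G N Λ) (SkewMonoidAlgebra L N) :=
    { carrier := (W : Set (SkewMonoidAlgebra L N)) ∩ (U : Set (SkewMonoidAlgebra L N))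
      zero_mem' := ⟨W.zero_mem, U.zero_mem⟩
      add_mem' := fun h h' => ⟨W.add_mem h.1 h'.1, U.add_mem h.2 h'.2⟩
      smul_mem' := by
        rintro ⟨c, hc⟩ X hX
        refine ⟨?_, U.mul_mem (hU hc) hX.2⟩
        obtain ⟨r, hr, rfl⟩ := hc
        exact W.smul_mem (⟨single 1 r, r, hr.2, rfl⟩ : baseField (G := G) L N) hX.1 }
  -- `W ∩ U` lies in the image of `Λ ^ F` under `(a_μ) ↦ ∑ δ⁻¹ a_μ μ`, which is noetherian over `Γ`.
  have hle : Q ≤ LinearMap.range (leftFamily (G := G) (Λ := Λ) F δ⁻¹) := by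
    intro X hX
    refine ⟨fun μ => ⟨δ * X.coeff μ, h X hX.2 (hF X hX.1) μ⟩, ?_⟩
    change ∑ μ : F, single (μ : N) (δ⁻¹ * (δ * X.coeff μ)) = X
    simp only [inv_mul_cancel_left₀ h0]
    rw [Finset.sum_coe_sort F fun μ => single μ (X.coeff μ)]
    conv_rhs => rw [← sum_single X, sum_def']
    exact (Finset.sum_subset (hF X hX.1) fun μ _ hμ => by simp [notMem_support_iff.1 hμ]).symm
  have : IsNoetherian (baseRing G N Λ) Q := isNoetherian_of_le hle
  obtain ⟨S, hS⟩ := (isNoetherian_submodule.1 this) Q le_rfl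
  exact ⟨S, congrArg _ hS⟩

lemma isFGRight_inter [IsNoetherian (invariantBase G Λ) (asBaseModule G Λ)]
    (hN : ∀ μ : N, ∀ a ∈ Λ, μ • a ∈ Λ)
    (hU : baseRing G N Λ ≤ U) (hden : HasBoundedDenominators Λ (U : Set (SkewMonoidAlgebra L N)))
    (W : Submodule (baseField (G := G) L N).op (SkewMonoidAlgebra L N)) (hW : W.FG) :
    IsFGRight (baseRing G N Λ)
      ((W : Set (SkewMonoidAlgebra L N)) ∩ (U : Set (SkewMonoidAlgebra L N))) := by
  obtain ⟨F, hF⟩ := exists_finset_support_of_fg (fun c X μ hμ => by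
    obtain ⟨c, r, hr, hc⟩ := c
    rw [mem_support_iff] at hμ ⊢
    intro h
    refine hμ ?_
    change (X * c.unop).coeff μ = 0
    rw [← hc]
    exact (coeff_mul_single_one X r μ).trans (by rw [h, zero_mul])) hW
  obtain ⟨δ, hδ, h0, h⟩ := exists_denominator_dagger hN hden F
  let Q : Submodule (baseRing G N Λ).op (SkewMonoidAlgebra L N) :=
    { carrier := (W : Set (SkewMonoidAlgebra L N)) ∩ (U : Set (SkewMonoidAlgebra L N))
      zero_mem' := ⟨W.zero_mem, U.zero_mem⟩
      add_mem' := fun h h' => ⟨W.add_mem h.1 h'.1, U.add_mem h.2 h'.2⟩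
      smul_mem' := by
        rintro ⟨c, hc⟩ X hX
        refine ⟨?_, U.mul_mem hX.2 (hU hc)⟩
        obtain ⟨r, hr, hc⟩ := hc
        exact W.smul_mem (⟨c, r, hr.2, hc⟩ : (baseField (G := G) L N).op) hX.1 }
  -- The same embedding with coefficients on the right, `X = ∑ μ (μ⁻¹(x_μ))`, so that right
  -- multiplication by `Γ` is linear on `Λ ^ F`.
  have hle : Q ≤ LinearMap.range (rightFamily (G := G) (Λ := Λ) F δ⁻¹) := by
    intro X hX
    refine ⟨fun μ => ⟨δ * ((μ : N)⁻¹ • X.coeff μ), h X hX.2 (hF X hX.1) μ⟩, ?_⟩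
    change ∑ μ : F, single (μ : N) ((μ : N) • (δ⁻¹ * (δ * ((μ : N)⁻¹ • X.coeff μ)))) = X
    simp only [inv_mul_cancel_left₀ h0, smul_inv_smul]
    rw [Finset.sum_coe_sort F fun μ => single μ (X.coeff μ)]
    conv_rhs => rw [← sum_single X, sum_def']
    exact (Finset.sum_subset (hF X hX.1) fun μ _ hμ => by simp [notMem_support_iff.1 hμ]).symm
  have : IsNoetherian (baseRing G N Λ).op Q := isNoetherian_of_le hle
  obtain ⟨S, hS⟩ := (isNoetherian_submodule.1 this) Q le_rfl
  exact ⟨S, congrArg _ hS⟩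

end Order

end GaloisOrder

namespace GaloisOrder

open SkewMonoidAlgebra Module SymmetricAlgebra

/-! ### Translations and linear maps on `S`: separation and finiteness -/

section Concrete

variable {k V : Type*} [Field k] [AddCommGroup V] [Module k V]

lemma lin_smul_algebraMap (g : V ≃ₗ[k] V) (p : PolyFun k V) :
    g • algebraMap (PolyFun k V) (RatFun k V) p =
      algebraMap (PolyFun k V) (RatFun k V) (linHom g p) :=
  IsFractionRing.ringEquivOfRingEquiv_algebraMap _ _

lemma trans_smul_algebraMap (w : Multiplicative V) (p : PolyFun k V) :
    w • algebraMap (PolyFun k V) (RatFun k V) p =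
      algebraMap (PolyFun k V) (RatFun k V) (transHom w.toAdd p) :=
  IsFractionRing.ringEquivOfRingEquiv_algebraMap _ _

lemma linHom_transHom (g : V ≃ₗ[k] V) (w : V) (p : PolyFun k V) :
    linHom g (transHom w p) = transHom (g w) (linHom g p) := by
  have h : (linHom g).comp (transHom w) = (transHom (k := k) (g w)).comp (linHom g) := by
    apply SymmetricAlgebra.algHom_ext
    ext α
    simp [contragredient_apply]
  exact DFunLike.congr_fun h p

lemma compatibleActions (G : Subgroup (V ≃ₗ[k] V)) :
    CompatibleActions G (Multiplicative V) (RatFun k V) where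
  smul_mul g μ ν := congrArg Multiplicative.ofAdd (map_add (g : V ≃ₗ[k] V) μ.toAdd ν.toAdd)
  smul_smul g μ a := by
    obtain ⟨p, q, _, rfl⟩ := IsFractionRing.div_surjective (PolyFun k V) a
    change (g : V ≃ₗ[k] V) • μ • (_ : RatFun k V) =
      (Multiplicative.ofAdd ((g : V ≃ₗ[k] V) μ.toAdd) : Multiplicative V) •
        (g : V ≃ₗ[k] V) • (_ : RatFun k V)
    simp only [smul_div₀', lin_smul_algebraMap, trans_smul_algebraMap, linHom_transHom, toAdd_ofAdd]

lemma mem_polySubring {a : RatFun k V} :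
    a ∈ polySubring k V ↔ ∃ p, algebraMap (PolyFun k V) (RatFun k V) p = a := Iff.rfl

lemma algebraMap_mem_polySubring (p : PolyFun k V) :
    algebraMap (PolyFun k V) (RatFun k V) p ∈ polySubring k V := ⟨p, rfl⟩

lemma trans_smul_mem_polySubring (w : Multiplicative V) {a : RatFun k V}
    (ha : a ∈ polySubring k V) : w • a ∈ polySubring k V := by
  obtain ⟨p, rfl⟩ := ha
  exact ⟨_, (trans_smul_algebraMap w p).symm⟩

lemma exists_mul_mem_polySubring (l : RatFun k V) :
    ∃ b ∈ polySubring k V, b ≠ 0 ∧ b * l ∈ polySubring k V := by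
  obtain ⟨p, q, hq, rfl⟩ := IsFractionRing.div_surjective (PolyFun k V) l
  have h0 : algebraMap (PolyFun k V) (RatFun k V) q ≠ 0 :=
    IsFractionRing.to_map_ne_zero_of_mem_nonZeroDivisors hq
  refine ⟨_, ⟨q, rfl⟩, h0, ?_⟩
  rw [div_eq_mul_inv, mul_left_comm, mul_inv_cancel₀ h0, mul_one]
  exact ⟨p, rfl⟩

lemma algebraMap_mem_invariantBase (G : Subgroup (V ≃ₗ[k] V)) {p : PolyFun k V}
    (hp : ∀ g ∈ G, linHom g p = p) :
    algebraMap (PolyFun k V) (RatFun k V) p ∈ invariantBase (L := RatFun k V) G (polySubring k V) :=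
  ⟨⟨p, rfl⟩, fun g => (lin_smul_algebraMap _ _).trans (by rw [hp g g.2])⟩

lemma card_ne_zero (G : Subgroup (V ≃ₗ[k] V)) (hchar : (Nat.card G : k) ≠ 0) :
    (Nat.card G : RatFun k V) ≠ 0 := by
  have h : ((Nat.card G : k) : k) ≠ 0 := hchar
  rw [← map_natCast ((algebraMap (PolyFun k V) (RatFun k V)).comp (algebraMap k (PolyFun k V)))]
  exact (map_ne_zero _).2 h

/-! #### Translations and linear maps -/

/-- Compare constant terms, that is, values at the origin: `g(α)` has none, while `t_w(α)` has
`-α(w)`. -/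
lemma eval_eq_zero_of_linHom_eq_transHom {g : V ≃ₗ[k] V} {w : V} {α : Dual k V}
    (h : transHom w (ι k (Dual k V) α) = linHom g (ι k (Dual k V) α)) : α w = 0 := by
  have h2 := congrArg (algebraMapInv (R := k) (M := Dual k V)) h
  rw [transHom_ι, linHom_ι, map_sub, algebraMapInv_ι, algebraMapInv_ι, AlgHom.commutes] at h2
  simpa using h2

/-- The action of `GL(V)` on polynomial functions. -/
@[reducible]
noncomputable def polyAction (G : Subgroup (V ≃ₗ[k] V)) : MulSemiringAction G (PolyFun k V) :=
  MulSemiringAction.compHom (PolyFun k V) ((linAction (k := k) (V := V)).comp G.subtype)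

/-- An endomorphism of a domain fixing the invariants of a finite group `G` maps every element to
one of its `G`-conjugates. -/
lemma exists_map_eq_smul {B G : Type*} [CommRing B] [IsDomain B] [Group G] [Finite G]
    [MulSemiringAction G B] (φ : B →+* B) (hφ : ∀ b, (∀ g : G, g • b = b) → φ b = b) (x : B) :
    ∃ g : G, φ x = g • x := by
  have := Fintype.ofFinite G
  -- The coefficients of `∏ (T - g x)` are `G`-invariant, so `φ` fixes them and must send the root
  -- `x` to another root.
  have hmap : (MulSemiringAction.charpoly G x).map φ = MulSemiringAction.charpoly G x := by
    ext n : 1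
    rw [Polynomial.coeff_map]
    exact hφ _ (MulSemiringAction.smul_coeff_charpoly x n)
  have h0 : (MulSemiringAction.charpoly G x).eval (φ x) = 0 := by
    rw [← hmap]
    refine (Polynomial.eval_map_apply (f := φ) _).trans ?_
    rw [MulSemiringAction.eval_charpoly, map_zero]
  rw [MulSemiringAction.charpoly_eq, Polynomial.eval_prod, Finset.prod_eq_zero_iff] at h0
  obtain ⟨g, -, hg⟩ := h0
  rw [Polynomial.eval_sub, Polynomial.eval_X, Polynomial.eval_C, sub_eq_zero] at hg
  exact ⟨g, hg⟩

/-- If `t_w` fixes `S^G`, it sends each linear form `α` to a `G`-conjugate, so `α(w) = 0`. The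
conjugating `g` may vary with `α`, which does no harm. -/
lemma transHom_separation (G : Subgroup (V ≃ₗ[k] V)) [Finite G] (μ : Multiplicative V)
    (hμ : ∀ r ∈ invariantBase (L := RatFun k V) G (polySubring k V), μ • r = r) : μ = 1 := by
  let := polyAction G
  have hfix : ∀ p : PolyFun k V, (∀ g : G, g • p = p) → transHom μ.toAdd p = p := by
    intro p hp
    have h := hμ _ (algebraMap_mem_invariantBase G fun g hg => hp ⟨g, hg⟩)
    rw [trans_smul_algebraMap] at h
    exact IsFractionRing.injective _ (RatFun k V) h
  refine (forall_dual_apply_eq_zero_iff k (V := V) μ.toAdd).1 fun α => ?_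
  obtain ⟨g, hg⟩ := exists_map_eq_smul (transHom (k := k) μ.toAdd).toRingHom hfix
    (ι k (Dual k V) α)
  have h : transHom μ.toAdd (ι k (Dual k V) α) = linHom (g : V ≃ₗ[k] V) (ι k (Dual k V) α) := hg
  exact eval_eq_zero_of_linHom_eq_transHom h

/-! #### Finiteness -/

instance finiteType_polyFun [FiniteDimensional k V] : Algebra.FiniteType k (PolyFun k V) :=
  Algebra.FiniteType.equiv inferInstance
    (equivMvPolynomial (finBasis k (Dual k V))).symm

/-- The invariants `S^G`, as a subalgebra of `S`. -/
def polyInvariants (G : Subgroup (V ≃ₗ[k] V)) : Subalgebra k (PolyFun k V) where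
  carrier := {p | ∀ g ∈ G, linHom g p = p}
  mul_mem' := fun h h' g hg => by rw [map_mul, h g hg, h' g hg]
  add_mem' := fun h h' g hg => by rw [map_add, h g hg, h' g hg]
  algebraMap_mem' := fun c g _ => (linHom g).commutes c

/-- Noether's argument: `S` is integral and of finite type over `S^G`, hence a finite module over
it, and it remains to see that `S^G` is noetherian. -/
lemma isNoetherian_polyInvariants [FiniteDimensional k V] (G : Subgroup (V ≃ₗ[k] V)) [Finite G] :
    IsNoetherian (polyInvariants G) (PolyFun k V) := by
  let := polyAction G
  have : Algebra.IsInvariant (polyInvariants G) (PolyFun k V) G :=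
    ⟨fun p hp => ⟨⟨p, fun g hg => hp ⟨g, hg⟩⟩, rfl⟩⟩
  have : SMulCommClass G (polyInvariants G) (PolyFun k V) :=
    ⟨fun g r p => (map_mul (linHom (g : V ≃ₗ[k] V)) (r : PolyFun k V) p).trans
      (by rw [r.2 g g.2]; rfl)⟩
  have : Algebra.IsIntegral (polyInvariants G) (PolyFun k V) :=
    Algebra.IsInvariant.isIntegral _ _ G
  have : Algebra.FiniteType (polyInvariants G) (PolyFun k V) :=
    Algebra.FiniteType.of_restrictScalars_finiteType k _ _
  have hfin : Module.Finite (polyInvariants G) (PolyFun k V) := Algebra.IsIntegral.finite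
  -- The Artin–Tate lemma for `k ⊆ S^G ⊆ S`.
  have : Algebra.FiniteType k (polyInvariants G) :=
    ⟨fg_of_fg_of_fg k (polyInvariants G) (PolyFun k V) (finiteType_polyFun (k := k) (V := V)).1
      hfin.1 Subtype.val_injective⟩
  have : IsNoetherianRing (polyInvariants G) := Algebra.FiniteType.isNoetherianRing k _
  exact isNoetherian_of_isNoetherianRing_of_finite _ _

/-- The embedding `S^G → R ⊆ L`. -/
noncomputable def polyInvariantsHom (G : Subgroup (V ≃ₗ[k] V)) :
    polyInvariants G →+* invariantBase (L := RatFun k V) G (polySubring k V) :=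
  ((algebraMap (PolyFun k V) (RatFun k V)).comp (polyInvariants G).val.toRingHom).codRestrict _
    fun p => algebraMap_mem_invariantBase G p.2

instance polyInvariantsHom_surjective (G : Subgroup (V ≃ₗ[k] V)) :
    RingHomSurjective (polyInvariantsHom G) := by
  refine ⟨?_⟩
  rintro ⟨_, ⟨p, rfl⟩, hp⟩
  refine ⟨⟨p, fun g hg => ?_⟩, rfl⟩
  have h := hp ⟨g, hg⟩
  exact IsFractionRing.injective _ (RatFun k V) ((lin_smul_algebraMap g p).symm.trans h)

/-- The semilinear map `S → L`. -/
noncomputable def polyToRat (G : Subgroup (V ≃ₗ[k] V)) :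
    PolyFun k V →ₛₗ[polyInvariantsHom G] asBaseModule (L := RatFun k V) G (polySubring k V) where
  toFun p := ⟨algebraMap (PolyFun k V) (RatFun k V) p, p, rfl⟩
  map_add' p q := Subtype.ext (map_add _ p q)
  map_smul' r p := Subtype.ext (map_mul (algebraMap (PolyFun k V) (RatFun k V)) (r : PolyFun k V) p)

lemma isNoetherian_asBaseModule [FiniteDimensional k V] (G : Subgroup (V ≃ₗ[k] V)) [Finite G] :
    IsNoetherian (invariantBase (L := RatFun k V) G (polySubring k V)) (asBaseModule (L := RatFun k V) G (polySubring k V)) := by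
  have := isNoetherian_polyInvariants G
  refine isNoetherian_of_surjective (polyToRat G) (LinearMap.range_eq_top.2 ?_)
  rintro ⟨_, p, rfl⟩
  exact ⟨p, rfl⟩

lemma standingAssumptions [FiniteDimensional k V] (G : Subgroup (V ≃ₗ[k] V)) [Finite G]
    (𝒳 : Set (SkewRatFun k V)) (hinv : ∀ X ∈ 𝒳, ∀ g : G, skewAct g X = X) :
    StandingAssumptions G (polySubring k V) (supportMonoid 𝒳) where
  finiteness := isNoetherian_asBaseModule G
  separation := by
    intro m₁ _ m₂ _ g h
    -- A translation that agrees with a linear map on `V*` is trivial, and then so is the action of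
    -- `g` on `S`.
    have hw : m₁ * m₂⁻¹ = 1 := by
      refine (forall_dual_apply_eq_zero_iff k (V := V) (m₁ * m₂⁻¹).toAdd).1 fun α => ?_
      refine eval_eq_zero_of_linHom_eq_transHom (g := g) ?_
      have h1 := h _ (algebraMap_mem_polySubring (ι k (Dual k V) α))
      rw [trans_smul_algebraMap] at h1
      exact IsFractionRing.injective _ (RatFun k V) (h1.trans (lin_smul_algebraMap _ _))
    intro a ha
    rw [← h a ha, hw, one_smul]
  invariance := by
    intro g μ hμ
    have hc := compatibleActions G
    induction hμ using Submonoid.closure_induction with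
    | mem μ h =>
      obtain ⟨X, hX, hμ⟩ := Set.mem_iUnion₂.1 h
      refine Submonoid.subset_closure (Set.mem_iUnion₂.2 ⟨X, hX, ?_⟩)
      rw [Finset.mem_coe, SkewMonoidAlgebra.mem_support_iff] at hμ ⊢
      rwa [← hinv X hX g, coeff_skewAct, Ne, smul_eq_zero_iff_eq]
    | one =>
      rw [hc.smul_one]
      exact one_mem _
    | mul μ ν _ _ h h' =>
      rw [hc.smul_mul]
      exact mul_mem h h'

end Concrete

end GaloisOrder

namespace GaloisOrder

open SkewMonoidAlgebra Module SymmetricAlgebra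

/-! ### Linear forms as primes of `S` -/

section LinearForms

variable {k V : Type*} [Field k] [AddCommGroup V] [Module k V]

lemma ι_injective : Function.Injective (ι k (Dual k V)) := by
  rw [injective_iff_map_eq_zero]
  intro α h
  ext v
  have h2 := congrArg (SymmetricAlgebra.lift (Dual.eval k V v)) h
  rwa [lift_ι_apply, map_zero] at h2

/-- An algebra endomorphism of `S` that is the identity on `V*` modulo `x` is the identity on `S`
modulo `x`. -/
lemma dvd_map_sub {x : PolyFun k V} (φ : PolyFun k V →ₐ[k] PolyFun k V)
    (h : ∀ β : Dual k V, x ∣ φ (ι k (Dual k V) β) - ι k (Dual k V) β) (p : PolyFun k V) :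
    x ∣ φ p - p := by
  have h2 : (Ideal.Quotient.mkₐ k (Ideal.span {x})).comp φ =
      Ideal.Quotient.mkₐ k (Ideal.span {x}) := by
    apply SymmetricAlgebra.algHom_ext
    ext β
    exact Ideal.Quotient.eq.2 (Ideal.mem_span_singleton.2 (h β))
  exact Ideal.mem_span_singleton.1 (Ideal.Quotient.eq.1 (DFunLike.congr_fun h2 p))

/-- Restriction of polynomial functions along the projection of `V` onto `ker α` with kernel
spanned by `v`, where `α v = 1`. -/
def restrictHom (α : Dual k V) (v : V) : PolyFun k V →ₐ[k] PolyFun k V :=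
  SymmetricAlgebra.lift
    (ι k (Dual k V) ∘ₗ (LinearMap.id - (Dual.eval k V v).smulRight α))

lemma restrictHom_ι (α β : Dual k V) (v : V) :
    restrictHom α v (ι k (Dual k V) β) = ι k (Dual k V) (β - β v • α) := by
  simp [restrictHom]

lemma restrictHom_self {α : Dual k V} {v : V} (h : α v = 1) :
    restrictHom α v (ι k (Dual k V) α) = 0 := by
  simp [restrictHom_ι, h]

/-- The restriction kills `α` and is the identity modulo `α`, so its kernel is exactly the ideal
`(α)`. -/
lemma ι_dvd_iff {α : Dual k V} {v : V} (h : α v = 1) (p : PolyFun k V) :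
    ι k (Dual k V) α ∣ p ↔ restrictHom α v p = 0 := by
  constructor
  · rintro ⟨q, rfl⟩
    rw [map_mul, restrictHom_self h, zero_mul]
  · intro hp
    have h2 := dvd_map_sub (x := ι k (Dual k V) α) (restrictHom α v) (fun β => by
      rw [restrictHom_ι, ← map_sub, sub_sub_cancel_left, map_neg, map_smul]
      exact (Dvd.intro_left (algebraMap k _ (β v)) (Algebra.smul_def _ _).symm).neg_right) p
    rwa [hp, zero_sub, dvd_neg] at h2

/-- The ideal `(α)` is the kernel of an endomorphism of the domain `S`. -/
lemma prime_ι {α : Dual k V} {v : V} (h : α v = 1) : Prime (ι k (Dual k V) α) := by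
  refine ⟨fun h0 => ?_, fun hu => ?_, fun p q hpq => ?_⟩
  · rw [← map_zero (ι k (Dual k V))] at h0
    simp [ι_injective h0] at h
  · have h2 := hu.map (restrictHom α v)
    rw [restrictHom_self h] at h2
    exact not_isUnit_zero h2
  · rw [ι_dvd_iff h, ι_dvd_iff h, ← mul_eq_zero, ← map_mul]
    exact (ι_dvd_iff h _).1 hpq

lemma eq_smul_of_ι_dvd_ι {α β : Dual k V} {v : V} (h : α v = 1)
    (hd : ι k (Dual k V) α ∣ ι k (Dual k V) β) : β = β v • α := by
  rw [ι_dvd_iff h, restrictHom_ι, ← map_zero (ι k (Dual k V))] at hd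
  exact sub_eq_zero.1 (ι_injective hd)

end LinearForms

/-! ### Invariant rational functions with denominator `d_χ` -/

section Hyperplanes

variable {k V : Type*} [Field k] [AddCommGroup V] [Module k V] {G : Subgroup (V ≃ₗ[k] V)}

instance finite_reflectingHyperplanes [Finite G] : Finite (reflectingHyperplanes G) := by
  refine Set.Finite.to_subtype ((Set.finite_range fun g : G => fixedSpace (g : V ≃ₗ[k] V)).subset ?_)
  rintro _ ⟨g, hg, -, rfl⟩
  exact ⟨⟨g, hg⟩, rfl⟩

/-- The zero form would have kernel `V`, which has codimension 0, not 1. -/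
lemma HyperplaneData.exists_form_eq_one (D : HyperplaneData G) (H : reflectingHyperplanes G) :
    ∃ v, D.form H v = 1 := by
  by_cases h0 : D.form H = 0
  · have h := D.ker_form H
    obtain ⟨H, g, hg, hr, rfl⟩ := H
    rw [h0, LinearMap.ker_zero] at h
    have h' : fixedSpace g = ⊤ := h.symm
    rw [IsPseudoReflection, h', finrank_zero_of_subsingleton] at hr
    omega
  · exact LinearMap.surjective h0 1

lemma HyperplaneData.gen_inv_apply (D : HyperplaneData G) {H : reflectingHyperplanes G} {v : V}
    (hv : D.form H v = 0) : ((D.gen H : V ≃ₗ[k] V)⁻¹) v = v := by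
  have h1 : D.gen H ∈ fixingSubgroup G ((H : Submodule k V) : Set V) := by
    rw [← D.zpowers_gen H]
    exact Subgroup.mem_zpowers _
  have h2 : v ∈ ((H : Submodule k V) : Set V) := by
    rw [← D.ker_form H]
    exact hv
  exact (inv_mem h1) ⟨v, h2⟩

/-- `s_H` acts on `V*` by `β ↦ β + β(u) α_H` for some `u ∈ V`. -/
lemma HyperplaneData.exists_contragredient_gen (D : HyperplaneData G)
    (H : reflectingHyperplanes G) :
    ∃ u : V, ∀ β : Dual k V,
      contragredient (D.gen H : V ≃ₗ[k] V) β = β + β u • D.form H := by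
  obtain ⟨v₀, h₀⟩ := D.exists_form_eq_one H
  -- Split `v` as its component in `H`, which `s_H` fixes, plus `α_H(v) v₀`; thus `u` measures how
  -- `s_H⁻¹` moves `v₀`.
  refine ⟨((D.gen H : V ≃ₗ[k] V)⁻¹) v₀ - v₀, fun β => ?_⟩
  ext v
  have h := D.gen_inv_apply (H := H) (v := v - D.form H v • v₀) (by simp [h₀])
  rw [map_sub, map_smul, sub_eq_iff_eq_add] at h
  rw [contragredient_apply, h]
  simp
  ring

/-- The map `β ↦ β + β(u) α` has determinant `1 + α(u)`. This is also the factor by which it scales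
`α`, which links the exponent `a_H` to the action on `α_H`. -/
lemma HyperplaneData.det_contragredient_gen [FiniteDimensional k V] (D : HyperplaneData G)
    {H : reflectingHyperplanes G} {u : V} (hu : ∀ β : Dual k V,
      contragredient (D.gen H : V ≃ₗ[k] V) β = β + β u • D.form H) :
    (LinearEquiv.det (contragredient (D.gen H : V ≃ₗ[k] V)) : k) = 1 + D.form H u := by
  rw [LinearEquiv.coe_det]
  have h : (contragredient (D.gen H : V ≃ₗ[k] V) : Dual k V →ₗ[k] Dual k V) =
      LinearMap.transvection (Dual.eval k V u) (D.form H) := by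
    ext β : 1
    exact hu β
  rw [h, LinearMap.transvection.det]
  rfl

/-- If `ζ ^ b = 1` with `0 < b ≤ a_H`, then `a_H - b` would satisfy the defining equation too,
against minimality. -/
lemma det_pow_ne_one (D : HyperplaneData G) (χ : G →* kˣ) (H : reflectingHyperplanes G) {b : ℕ}
    (hb : 0 < b) (hle : b ≤ hyperplaneExponent D χ H) :
    LinearEquiv.det (contragredient (D.gen H : V ≃ₗ[k] V)) ^ b ≠ 1 := by
  intro h
  -- The infimum of the empty set is 0 by convention, so a positive exponent shows that the set is
  -- non-empty and that `a_H` belongs to it.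
  have hmem := Nat.sInf_mem (Nat.nonempty_of_pos_sInf (hb.trans_le hle))
  have h2 : hyperplaneExponent D χ H ≤ hyperplaneExponent D χ H - b := by
    refine Nat.sInf_le ?_
    rw [Set.mem_ofPred_eq] at hmem ⊢
    rw [hmem, ← mul_one (_ ^ (_ - b)), ← h, ← pow_add, Nat.sub_add_cancel hle]
    rfl
  omega

/-- Divisibility makes the two forms proportional, so their kernels coincide. -/
lemma HyperplaneData.not_ι_form_dvd (D : HyperplaneData G) {H H' : reflectingHyperplanes G}
    (h : H' ≠ H) : ¬ ι k (Dual k V) (D.form H) ∣ ι k (Dual k V) (D.form H') := by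
  intro hd
  obtain ⟨v, hv⟩ := D.exists_form_eq_one H
  obtain ⟨v', hv'⟩ := D.exists_form_eq_one H'
  have h2 := eq_smul_of_ι_dvd_ι hv hd
  have h0 : D.form H' v ≠ 0 := by
    intro h0
    rw [h0, zero_smul] at h2
    simp [h2] at hv'
  refine h (Subtype.ext ?_)
  rw [← D.ker_form H', ← D.ker_form H, h2, LinearMap.ker_smul _ _ h0]

/-- The product of the linear forms `α_H` with multiplicities `b_H`. -/
noncomputable def formProduct [Fintype (reflectingHyperplanes G)] (D : HyperplaneData G)
    (b : reflectingHyperplanes G → ℕ) : PolyFun k V :=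
  ∏ H, ι k (Dual k V) (D.form H) ^ b H

/-- If `s_H` scales `α_H` by `ζ` with `ζ ^ b ≠ 1`, and a `G`-invariant rational function times
`α_H ^ b q`, with `q` prime to `α_H`, is the polynomial `p`, then `α_H` divides `p`. -/
lemma HyperplaneData.ι_form_dvd_of_invariant (D : HyperplaneData G) {H : reflectingHyperplanes G}
    {u : V} (hu : ∀ β : Dual k V, contragredient (D.gen H : V ≃ₗ[k] V) β = β + β u • D.form H)
    {b : ℕ} (hb : (1 + D.form H u) ^ b ≠ 1) {f : RatFun k V}
    (hf : (D.gen H : V ≃ₗ[k] V) • f = f) {p q : PolyFun k V}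
    (hq : ¬ ι k (Dual k V) (D.form H) ∣ q)
    (hp : algebraMap (PolyFun k V) (RatFun k V) p =
      algebraMap (PolyFun k V) (RatFun k V) (ι k (Dual k V) (D.form H) ^ b * q) * f) :
    ι k (Dual k V) (D.form H) ∣ p := by
  obtain ⟨v, hv⟩ := D.exists_form_eq_one H
  set s : V ≃ₗ[k] V := (D.gen H).1
  set x := ι k (Dual k V) (D.form H)
  set z : PolyFun k V := algebraMap k (PolyFun k V) ((1 + D.form H u) ^ b)
  have hx : Prime x := prime_ι hv
  have hsx : linHom s x = algebraMap k (PolyFun k V) (1 + D.form H u) * x := by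
    rw [linHom_ι, hu, ← Algebra.smul_def, ← map_smul, add_smul, one_smul]
  have hs : ∀ r, x ∣ linHom s r - r := dvd_map_sub _ fun β => by
    rw [linHom_ι, hu, ← map_sub, add_sub_cancel_left, map_smul]
    exact Dvd.intro_left _ (Algebra.smul_def _ _).symm
  have hsp : algebraMap (PolyFun k V) (RatFun k V) (linHom s p) =
      algebraMap (PolyFun k V) (RatFun k V) (linHom s (x ^ b * q)) * f := by
    rw [← lin_smul_algebraMap, hp, smul_mul', hf, lin_smul_algebraMap]
  have heq : p * linHom s (x ^ b * q) = linHom s p * (x ^ b * q) := by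
    apply IsFractionRing.injective (PolyFun k V) (RatFun k V)
    refine ((map_mul _ _ _).trans ?_).trans (map_mul _ _ _).symm
    rw [hp, hsp]
    ring
  -- Here `s x = (1 + α_H(u)) x`, so the common factor `x ^ b` cancels and leaves the constant `z`
  -- behind.
  have hcancel : z * p * linHom s q = linHom s p * q := by
    refine mul_left_cancel₀ (pow_ne_zero b hx.ne_zero) ?_
    rw [map_mul, map_pow, hsx, mul_pow, ← map_pow] at heq
    linear_combination heq
  -- Modulo `x`, `s` is the identity, so `hcancel` reads `z p q ≡ p q`.
  have hdvd : x ∣ (z - 1) * (p * q) := by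
    have h1 := (hs p).mul_left q
    have h2 := (hs q).mul_left (z * p)
    convert h1.sub h2 using 1
    linear_combination hcancel
  have hz : IsUnit (z - 1) := by
    have : z - 1 = algebraMap k (PolyFun k V) ((1 + D.form H u) ^ b - 1) := by
      rw [map_sub, map_one]
    rw [this]
    exact (isUnit_iff_ne_zero.2 (sub_ne_zero.2 hb)).map _
  exact (hx.dvd_or_dvd (hz.dvd_mul_left.1 hdvd)).resolve_right hq

/-- Induction on the total multiplicity, removing one linear factor at a time. Lowering some `b H`
keeps `b ≤ a_H`, so the power of `ζ` met at each stage still differs from 1. -/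
lemma mem_polySubring_of_formProduct_mul [FiniteDimensional k V]
    [Fintype (reflectingHyperplanes G)] (D : HyperplaneData G) (χ : G →* kˣ) {f : RatFun k V}
    (hf : ∀ g : G, g • f = f) (n : ℕ) : ∀ (b : reflectingHyperplanes G → ℕ), ∑ H, b H = n →
      (∀ H, b H ≤ hyperplaneExponent D χ H) →
      algebraMap (PolyFun k V) (RatFun k V) (formProduct D b) * f ∈ polySubring k V →
      f ∈ polySubring k V := by
  classical
  induction n with
  | zero =>
    intro b hb _ h
    have h0 : ∀ H, b H = 0 := fun H => (Finset.sum_eq_zero_iff.1 hb) H (Finset.mem_univ H)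
    simpa [formProduct, h0] using h
  | succ n ih =>
    intro b hb hle h
    obtain ⟨H, hH⟩ : ∃ H, b H ≠ 0 := by
      by_contra! h0
      simp [h0] at hb
    obtain ⟨m, hm⟩ := Nat.exists_eq_succ_of_ne_zero hH
    obtain ⟨u, hu⟩ := D.exists_contragredient_gen H
    obtain ⟨v, hv⟩ := D.exists_form_eq_one H
    obtain ⟨p, hp⟩ := h
    set x := ι k (Dual k V) (D.form H)
    set q := ∏ H' ∈ Finset.univ.erase H, ι k (Dual k V) (D.form H') ^ b H'
    have hx : Prime x := prime_ι hv
    have hprod : formProduct D b = x ^ b H * q :=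
      (Finset.mul_prod_erase _ _ (Finset.mem_univ H)).symm
    have hprod' : formProduct D (Function.update b H m) = x ^ m * q := by
      rw [formProduct, ← Finset.mul_prod_erase _ _ (Finset.mem_univ H), Function.update_self]
      congr 1
      exact Finset.prod_congr rfl fun H' h' => by
        rw [Function.update_of_ne (Finset.ne_of_mem_erase h')]
    have hq : ¬ x ∣ q := by
      intro hd
      obtain ⟨H', h', hd⟩ := hx.exists_mem_finset_dvd hd
      exact D.not_ι_form_dvd (Finset.ne_of_mem_erase h') (hx.dvd_of_dvd_pow hd)
    have hζ : (1 + D.form H u) ^ b H ≠ 1 := by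
      rw [← D.det_contragredient_gen hu, ← Units.val_pow_eq_pow_val, Ne, Units.val_eq_one]
      exact det_pow_ne_one D χ H (Nat.pos_of_ne_zero hH) (hle H)
    rw [hprod] at hp
    -- The polynomial `p = x ^ b_H q f` is divisible by `x`; cancelling this `x` leaves the same
    -- situation with `b_H` lowered by one.
    obtain ⟨p', rfl⟩ := D.ι_form_dvd_of_invariant hu hζ (hf (D.gen H)) hq hp
    refine ih (Function.update b H m) ?_ (fun H' => ?_) ⟨p', ?_⟩
    · have h1 : b H + ∑ H' ∈ Finset.univ.erase H, b H' = ∑ H', b H' :=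
        Finset.add_sum_erase _ _ (Finset.mem_univ H)
      rw [← Finset.add_sum_erase _ _ (Finset.mem_univ H), Function.update_self,
        Finset.sum_congr rfl fun H' h' => by
          rw [Function.update_of_ne (Finset.ne_of_mem_erase h')]]
      change m + ∑ H' ∈ Finset.univ.erase H, b H' = n
      omega
    · rcases eq_or_ne H' H with rfl | h'
      · rw [Function.update_self]
        have := hle H'
        omega
      · rw [Function.update_of_ne h']
        exact hle H'
    · have hx0 : algebraMap (PolyFun k V) (RatFun k V) x ≠ 0 :=
        (map_ne_zero_iff _ (IsFractionRing.injective _ _)).2 hx.ne_zero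
      refine mul_left_cancel₀ hx0 ?_
      rw [← map_mul, hp, hprod', hm, ← mul_assoc, ← map_mul, ← mul_assoc, ← pow_succ']

/-- A `G`-invariant rational function with denominator `d_χ` is a polynomial. -/
lemma mem_polySubring_of_relativeJacobian_mul [FiniteDimensional k V] [Finite G]
    (D : HyperplaneData G) (χ : G →* kˣ) {f : RatFun k V} (hf : ∀ g : G, g • f = f)
    (h : algebraMap (PolyFun k V) (RatFun k V) (relativeJacobian D χ) * f ∈ polySubring k V) :
    f ∈ polySubring k V := by
  have := Fintype.ofFinite (reflectingHyperplanes G)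
  refine mem_polySubring_of_formProduct_mul D χ hf _ _ rfl (fun _ => le_rfl) ?_
  rwa [relativeJacobian, finprod_eq_prod_of_fintype] at h

end Hyperplanes

end GaloisOrder

namespace GaloisOrder

open SkewMonoidAlgebra Module

/-! ### Elements whose evaluation preserves `Γ` -/

section Evaluations

variable {G L N : Type*} [Field L] [Group N] [MulSemiringAction N L] [Group G]
  [MulSemiringAction G L]

/-- The subring of the elements of `L ∗ N` whose evaluation preserves `Γ`. -/
def evaluationSubring (G : Type*) [Group G] [MulSemiringAction G L] (N : Type*) [Group N]
    [MulSemiringAction N L] (Λ : Subring L) : Subring (SkewMonoidAlgebra L N) where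
  carrier := {X | ∀ r ∈ invariantBase G Λ, evaluation X r ∈ invariantBase G Λ}
  zero_mem' r _ := by
    rw [evaluation_zero_left]
    exact zero_mem _
  one_mem' r hr := by rwa [evaluation_one]
  add_mem' h h' r hr := by
    rw [evaluation_add_left]
    exact add_mem (h r hr) (h' r hr)
  neg_mem' h r hr := by
    rw [evaluation_neg_left]
    exact neg_mem (h r hr)
  mul_mem' h h' r hr := by
    rw [evaluation_mul]
    exact h _ (h' r hr)

lemma baseRing_le_evaluationSubring (Λ : Subring L) :
    baseRing G N Λ ≤ evaluationSubring G N Λ := by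
  rintro _ ⟨c, hc, rfl⟩ r hr
  change evaluation (single 1 c) r ∈ _
  rw [evaluation_single, one_smul]
  exact mul_mem hc hr

lemma baseRing_le_daggerSubring {Λ : Subring L} {U : Subring (SkewMonoidAlgebra L N)}
    (hU : baseRing G N Λ ≤ U) : baseRing G N Λ ≤ daggerSubring U := by
  rintro _ ⟨c, hc, rfl⟩
  rw [mem_daggerSubring]
  change dagger (single 1 c) ∈ U
  rw [dagger_single_one]
  exact hU (single_mem_baseRing hc)

end Evaluations

/-! ### Galois orders generated by `Γ` and invariant elements -/

section Generated

variable {G L N : Type*} [Field L] [Group N] [MulSemiringAction N L] [Group G]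
  [MulSemiringAction G L] [MulAction G N] [Finite G] {Λ : Subring L}

/-- A subring generated by `Γ` and invariant elements is a Galois `Γ`-order if its elements with
support in a given finite set have a common denominator. -/
lemma isGaloisOrder_closure [IsNoetherian (invariantBase G Λ) (asBaseModule G Λ)]
    (hc : CompatibleActions G N L) (hcard : (Nat.card G : L) ≠ 0)
    (hsep : ∀ μ : N, (∀ r ∈ invariantBase G Λ, μ • r = r) → μ = 1)
    (hN : ∀ μ : N, ∀ a ∈ Λ, μ • a ∈ Λ) {𝒳 : Set (SkewMonoidAlgebra L N)}
    (hinv : ∀ X ∈ 𝒳, ∀ g : G, skewAct g X = X)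
    (hden : HasBoundedDenominators Λ
      (Subring.closure (baseRing G N Λ ∪ 𝒳) : Set (SkewMonoidAlgebra L N))) :
    IsGaloisOrder (baseRing G N Λ) (baseField (G := G) L N)
      (invariants G L (Submonoid.closure (⋃ X ∈ 𝒳, (X.support : Set N))))
      (Subring.closure (baseRing G N Λ ∪ 𝒳)) := by
  have hbase : baseRing G N Λ ≤ Subring.closure (baseRing G N Λ ∪ 𝒳) :=
    fun X hX => Subring.subset_closure (Or.inl hX)
  have h𝒳 : 𝒳 ⊆ Subring.closure (baseRing G N Λ ∪ 𝒳) :=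
    fun X hX => Subring.subset_closure (Or.inr hX)
  have hle : Subring.closure (baseRing G N Λ ∪ 𝒳) ≤
      invariantSubring hc (Submonoid.closure (⋃ X ∈ 𝒳, (X.support : Set N))) := by
    refine Subring.closure_le.2 (Set.union_subset ?_ fun X hX => ⟨fun μ hμ => ?_, hinv X hX⟩)
    · rintro _ ⟨r, hr, rfl⟩
      exact single_one_mem_invariants hc _ hr.2
    · exact Submonoid.subset_closure (Set.mem_iUnion₂.2 ⟨X, hX, hμ⟩)
  exact
    { isGaloisRing_of_support hc hcard hsep hbase hle fun μ hμ =>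
        exists_mem_support_of_mem_closure hsep hbase h𝒳 hμ with
      left_order := fun W hW _ => isFGLeft_inter hbase hden W hW
      right_order := fun W hW _ => isFGRight_inter hN hbase hden W hW }

lemma isPrincipalGaloisOrder_closure [IsNoetherian (invariantBase G Λ) (asBaseModule G Λ)]
    (hc : CompatibleActions G N L) (hcard : (Nat.card G : L) ≠ 0)
    (hsep : ∀ μ : N, (∀ r ∈ invariantBase G Λ, μ • r = r) → μ = 1)
    (hN : ∀ μ : N, ∀ a ∈ Λ, μ • a ∈ Λ) (hfrac : ∀ l : L, ∃ b ∈ Λ, b ≠ 0 ∧ b * l ∈ Λ)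
    {𝒳 : Set (SkewMonoidAlgebra L N)} (hinv : ∀ X ∈ 𝒳, ∀ g : G, skewAct g X = X)
    (h𝒳 : ∀ X ∈ 𝒳, X ∈ evaluationSubring G N Λ) :
    IsPrincipalGaloisOrder G Λ (Submonoid.closure (⋃ X ∈ 𝒳, (X.support : Set N)))
      (Subring.closure (baseRing G N Λ ∪ 𝒳)) := by
  have hev : Subring.closure (baseRing G N Λ ∪ 𝒳) ≤ evaluationSubring G N Λ :=
    Subring.closure_le.2 (Set.union_subset (baseRing_le_evaluationSubring _) h𝒳)
  have h := isGaloisOrder_closure hc hcard hsep hN hinv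
    (hasBoundedDenominators_of_evaluation hfrac hsep fun X hX r hr => (hev hX r hr).1)
  exact ⟨h, fun X hX => ⟨h.le_invariants hX, hev hX⟩⟩

lemma isCoprincipalGaloisOrder_closure [IsNoetherian (invariantBase G Λ) (asBaseModule G Λ)]
    (hc : CompatibleActions G N L) (hcard : (Nat.card G : L) ≠ 0)
    (hsep : ∀ μ : N, (∀ r ∈ invariantBase G Λ, μ • r = r) → μ = 1)
    (hN : ∀ μ : N, ∀ a ∈ Λ, μ • a ∈ Λ) (hfrac : ∀ l : L, ∃ b ∈ Λ, b ≠ 0 ∧ b * l ∈ Λ)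
    {𝒳 : Set (SkewMonoidAlgebra L N)} (hinv : ∀ X ∈ 𝒳, ∀ g : G, skewAct g X = X)
    (h𝒳 : ∀ X ∈ 𝒳, dagger X ∈ evaluationSubring G N Λ) :
    IsCoprincipalGaloisOrder G Λ (Submonoid.closure (⋃ X ∈ 𝒳, (X.support : Set N)))
      (Subring.closure (baseRing G N Λ ∪ 𝒳)) := by
  have hev : Subring.closure (baseRing G N Λ ∪ 𝒳) ≤ daggerSubring (evaluationSubring G N Λ) :=
    Subring.closure_le.2 (Set.union_subset
      (baseRing_le_daggerSubring (baseRing_le_evaluationSubring _)) h𝒳)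
  -- Integrality of values bounds the denominators of `U†`, and the bound passes back to `U` because
  -- `N` preserves `Λ`.
  have h := isGaloisOrder_closure hc hcard hsep hN hinv
    (HasBoundedDenominators.of_dagger hN
      (hasBoundedDenominators_of_evaluation hfrac hsep fun X hX r hr => by
        have h := hev hX
        rw [mem_daggerSubring, dagger_dagger] at h
        exact (h r hr).1))
  exact ⟨h, fun X hX => ⟨h.le_invariants hX, hev hX⟩⟩

end Generated

/-! ### The principal and co-principal cases -/

section Main

variable {k V : Type*} [Field k] [AddCommGroup V] [Module k V] [FiniteDimensional k V]
  {G : Subgroup (V ≃ₗ[k] V)} [Finite G]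

/-- For `r ∈ R`, `X(r)` is invariant and `d_χ X(r) = ∑ (d_χ x_μ) μ(r)` is a polynomial, so `X(r)` is
itself a polynomial. -/
lemma mem_evaluationSubring_of_relativeJacobian (D : HyperplaneData G) (χ : G →* kˣ) {X : SkewRatFun k V}
    (hinv : ∀ g : G, skewAct g X = X)
    (hX : ∀ μ, algebraMap (PolyFun k V) (RatFun k V) (relativeJacobian D χ) * X.coeff μ ∈
      polySubring k V) :
    X ∈ evaluationSubring (L := RatFun k V) G (Multiplicative V) (polySubring k V) := by
  intro r hr
  have hG : ∀ g : G, g • evaluation X r = evaluation X r := fun g => by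
    rw [smul_evaluation (compatibleActions G), hinv, hr.2 g]
  refine ⟨mem_polySubring_of_relativeJacobian_mul D χ hG ?_, hG⟩
  rw [evaluation_eq_sum subset_rfl, Finset.mul_sum]
  refine sum_mem fun μ _ => ?_
  rw [← mul_assoc]
  exact mul_mem (hX μ) (trans_smul_mem_polySubring μ hr.1)

lemma isPrincipalGaloisOrder_generatedRing (hchar : (Nat.card G : k) ≠ 0) (D : HyperplaneData G)
    {𝒳 : Set (SkewRatFun k V)} (hinv : ∀ X ∈ 𝒳, ∀ g : G, skewAct g X = X)
    (h𝒳 : ∀ X ∈ 𝒳, ∃ χ : G →* kˣ,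
      polyToSkew (relativeJacobian D χ) * X ∈ integralElements (polySubring k V)) :
    IsPrincipalGaloisOrder G (polySubring k V) (supportMonoid 𝒳) (generatedRing G 𝒳) := by
  have := isNoetherian_asBaseModule G
  refine isPrincipalGaloisOrder_closure (compatibleActions G) (card_ne_zero G hchar)
    (transHom_separation G) (fun μ a ha => trans_smul_mem_polySubring μ ha)
    exists_mul_mem_polySubring hinv fun X hX => ?_
  obtain ⟨χ, hχ⟩ := h𝒳 X hX
  refine mem_evaluationSubring_of_relativeJacobian D χ (hinv X hX) fun μ => ?_
  have h := hχ μ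
  rwa [polyToSkew, coeff_single_one_mul] at h

lemma isCoprincipalGaloisOrder_generatedRing (hchar : (Nat.card G : k) ≠ 0)
    (D : HyperplaneData G) {𝒳 : Set (SkewRatFun k V)}
    (hinv : ∀ X ∈ 𝒳, ∀ g : G, skewAct g X = X)
    (h𝒳 : ∀ X ∈ 𝒳, ∃ χ : G →* kˣ,
      X * polyToSkew (relativeJacobian D χ) ∈ integralElements (polySubring k V)) :
    IsCoprincipalGaloisOrder G (polySubring k V) (supportMonoid 𝒳) (generatedRing G 𝒳) := by
  have := isNoetherian_asBaseModule G
  refine isCoprincipalGaloisOrder_closure (compatibleActions G) (card_ne_zero G hchar)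
    (transHom_separation G) (fun μ a ha => trans_smul_mem_polySubring μ ha)
    exists_mul_mem_polySubring hinv fun X hX => ?_
  obtain ⟨χ, hχ⟩ := h𝒳 X hX
  refine mem_evaluationSubring_of_relativeJacobian D χ
    (fun g => by rw [skewAct_dagger (compatibleActions G), hinv X hX]) fun μ => ?_
  -- The coefficient of `X d_χ` at `μ⁻¹` is `x_{μ⁻¹} μ⁻¹(d_χ)`. Applying `μ` gives `d_χ` times the
  -- coefficient of `X†` at `μ`, so `X†` satisfies the condition of the principal case.
  have h := trans_smul_mem_polySubring μ (hχ μ⁻¹)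
  rwa [polyToSkew, coeff_mul_single_one, smul_mul', smul_inv_smul, mul_comm,
    ← coeff_dagger] at h

end Main

end GaloisOrder

theorem mainTheorem4 {k V : Type*} [Field k] [AddCommGroup V] [Module k V] [FiniteDimensional k V]
    (G : Subgroup (V ≃ₗ[k] V)) [Finite G] (hchar : (Nat.card G : k) ≠ 0)
    (hG : IsReflectionGroup G) (D : HyperplaneData G)
    (𝒳 : Set (SkewRatFun k V)) (hinv : ∀ X ∈ 𝒳, ∀ g : G, skewAct g X = X) :
    StandingAssumptions G (polySubring k V) (supportMonoid 𝒳) ∧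
    ((∀ X ∈ 𝒳, ∃ χ : G →* kˣ,
        polyToSkew (relativeJacobian D χ) * X ∈ integralElements (polySubring k V)) →
      IsPrincipalGaloisOrder G (polySubring k V) (supportMonoid 𝒳) (generatedRing G 𝒳)) ∧
    ((∀ X ∈ 𝒳, ∃ χ : G →* kˣ,
        X * polyToSkew (relativeJacobian D χ) ∈ integralElements (polySubring k V)) →
      IsCoprincipalGaloisOrder G (polySubring k V) (supportMonoid 𝒳) (generatedRing G 𝒳)) :=
  ⟨standingAssumptions G 𝒳 hinv, isPrincipalGaloisOrder_generatedRing hchar D hinv,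
    isCoprincipalGaloisOrder_generatedRing hchar D hinv⟩
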